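/- For integers $0\le r$ and $0\le t$ let $S_{r,1,t}:=\sum_{1\le i_1<\dots<i_r\le t}\frac{1}{i_1\cdots i_r}$ (so $S_{0,1,t}=1$, and $S_{r,1,t}=0$ for $t<r$). Let $B_k$ be the Bernoulli numbers with $B_1=-\tfrac12$, $\gamma$ Euler's constant, $\zeta$ the Riemann zeta function and $\zeta^{(p)}$ its $p$-th derivative. Let $p\ge 1$ be an integer, and put $$c_{p,r}:=\frac{(-1)^r p!}{(p-r)!}\,\zeta(r+1),\qquad d_{p,r,k}:=\frac{(-1)^r p!}{(p-r)!}\,S_{r-1,1,k-1}\qquad(1\le r\le p,\ k\ge 1).$$ Then for every integer $m\ge 0$, as $n\to\infty$ through the positive integers, $$\sum_{k=1}^{n-1}\frac{(\log k)^p}{n-k}=(\log n)^{p+1}+\gamma(\log n)^p+\sum_{r=1}^{p}c_{p,r}(\log n)^{p-r}-\sum_{k=1}^{m}\Big(\frac{(-1)^kB_k}{k^2}\sum_{r=1}^{p}d_{p,r,k}(\log n)^{p-r}-(-1)^p\zeta^{(p)}(1-k)\Big)\frac1{n^k}+O\Big(\frac{(\log n)^{p-1}}{n^{m+1}}\Big),$$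 where the implied constant may depend on $p$ and $m$. Hence the constant term of the expansion is $(-1)^p p!\,\zeta(p+1)$, that is, $$\lim_{n\to\infty}\Big(\sum_{k=1}^{n-1}\frac{(\log k)^p}{n-k}-(\log n)^{p+1}-\gamma(\log n)^p-\sum_{r=1}^{p-1}c_{p,r}(\log n)^{p-r}\Big)=(-1)^p\,p!\,\zeta(p+1).$$ -/

import Mathlib

open Filter Topology Asymptotics

namespace LogSum

/-- `S r s t = ∑ 1 / (i₁ ⋯ i_r)`, the sum over all integers `s ≤ i₁ < ⋯ < i_r ≤ t`
(so `S 0 s t = 1`, the empty product). The increasing `r`-tuples are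
the `r`-element subsets of `{s, …, t}`. -/
def S (r s t : ℕ) : ℚ :=
  ∑ A ∈ (Finset.Icc s t).powersetCard r, ∏ i ∈ A, (1 / (i : ℚ))

/-- `c_{p,r} = (-1)^r p! / (p-r)! · ζ(r+1)`, used for `1 ≤ r ≤ p`. -/
noncomputable def c (p r : ℕ) : ℂ :=
  (-1) ^ r * (p.factorial : ℂ) / ((p - r).factorial : ℂ) * riemannZeta ((r : ℂ) + 1)

/-- `d_{p,r,k} = (-1)^r p! / (p-r)! · S_{r-1,1,k-1}`, used for `1 ≤ r ≤ p` and `1 ≤ k`. -/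
def d (p r k : ℕ) : ℚ :=
  (-1) ^ r * (p.factorial : ℚ) / ((p - r).factorial : ℚ) * S (r - 1) 1 (k - 1)

/-- The sum `∑_{k=1}^{n-1} (log k)^p / (n-k)`. -/
noncomputable def logSum (p n : ℕ) : ℝ :=
  ∑ k ∈ Finset.Ico 1 n, Real.log k ^ p / ((n : ℝ) - (k : ℝ))

/-- The coefficient of `1 / n^k` (`1 ≤ k`) in the expansion; it depends on `n` through `log n`:
`-( (-1)^k B_k / k² · ∑_{r=1}^p d_{p,r,k} (log n)^{p-r} - (-1)^p ζ^{(p)}(1-k) )`.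
Here `bernoulli` has `B_1 = -1/2`. -/
noncomputable def coeff (p k n : ℕ) : ℂ :=
  -((-1) ^ k * (bernoulli k : ℂ) / (k : ℂ) ^ 2 *
      ∑ r ∈ Finset.Icc 1 p, (d p r k : ℂ) * (Real.log n : ℂ) ^ (p - r)
    - (-1) ^ p * iteratedDeriv p riemannZeta (1 - (k : ℂ)))

end LogSum

/-!
The sum is the `p`-th derivative at `z = 0` of `∑_{1 ≤ k < n} k ^ z / (n - k)`, so by Cauchy's
estimates it is enough to expand this sum uniformly for `z` near `0`.

When `re z` is large, `k ^ z = n ^ z * (1 - (1 - (k / n) ^ z))` turns it into a harmonic sum minus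
a Riemann sum of the smooth function `(1 - x ^ z) / (1 - x)`, and Euler-Maclaurin summation of both
gives `n ^ z * F n z`, where `F n z = log n + γ - H z - ∑ i, B_i / (i * n ^ i) * (z choose i)` and
`H z = ∑ l, (1 / l - 1 / (z + l))` is the harmonic function. The identity
`k ^ z / (n - k) = (k ^ z + k ^ (z + 1) / (n - k)) / n` relates the sums at `z` and `z + 1`; each
step down trades a power sum, with its constant `ζ(-z)`, for a factor `1 / n`, and `F` satisfies
the same recursion. Descending from `re z` large to `z` near `0` therefore produces the terms
`ζ(-z - j) / n ^ (j + 1)`.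

At `z = 0`, the derivatives of `H` are zeta values, and the coefficients of the falling factorial
`z (z - 1) ⋯ (z - i + 1)` are, up to sign and `(i - 1)!`, the numbers `S_{r, 1, i - 1}`.
-/

namespace LogSum

section EulerMaclaurin

/-- The coefficient `Bᵢ₊₁ / (i + 1)!` of the `i`-th derivative in the Euler–Maclaurin formula. -/
noncomputable def emCoeff (i : ℕ) : ℝ := bernoulli (i + 1) / (i + 1).factorial

variable {E : Type*} [NormedAddCommGroup E] [NormedSpace ℝ E]

/-- The first `N` boundary terms at `x` of the Euler–Maclaurin formula, for a function `f 0` whose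
`i`-th derivative is `f i`. -/
noncomputable def emBoundary (N : ℕ) (f : ℕ → ℝ → E) (x : ℝ) : E :=
  ∑ i ∈ Finset.range N, emCoeff i • f i x

theorem emBoundary_one (f : ℕ → ℝ → E) (x : ℝ) : emBoundary 1 f x = (-1 / 2 : ℝ) • f 0 x := by
  simp [emBoundary, emCoeff]

theorem emBoundary_succ (N : ℕ) (f : ℕ → ℝ → E) (x : ℝ) :
    emBoundary (N + 1) f x = emBoundary N f x + emCoeff N • f N x :=
  Finset.sum_range_succ _ _

theorem neg_one_pow_mul_bernoulliFun_eval_zero (N : ℕ) :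
    (-1 : ℝ) ^ N / (N + 2).factorial * bernoulliFun (N + 2) 0 = emCoeff (N + 1) := by
  have hparity : (-1) ^ (N + 2) * bernoulli (N + 2) = bernoulli (N + 2) := by
    rw [bernoulli_eq_bernoulli'_of_ne_one (by omega), ← bernoulli,
      bernoulli_eq_bernoulli'_of_ne_one (by omega)]
  have hparity_real : (-1 : ℝ) ^ N * (bernoulli (N + 2) : ℝ) = bernoulli (N + 2) := by
    rw [pow_add, neg_one_sq, mul_one] at hparity
    exact_mod_cast hparity
  rw [bernoulliFun_eval_zero, emCoeff, div_mul_eq_mul_div, hparity_real]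

variable [CompleteSpace E] {N : ℕ} {f : ℕ → ℝ → E} {a : ℝ}

theorem integral_bernoulliFun_smul_deriv {f f' : ℝ → E}
    (hf : ∀ y ∈ Set.Icc a (a + 1), HasDerivAt f (f' y) y)
    (hf' : ContinuousOn f' (Set.Icc a (a + 1))) :
    ∫ y in a..a + 1, bernoulliFun (N + 1) (y - a) • f' y =
      bernoulliFun (N + 1) 1 • f (a + 1) - bernoulliFun (N + 1) 0 • f a
        - ((N : ℝ) + 1) • ∫ y in a..a + 1, bernoulliFun N (y - a) • f y := by
  rw [← Set.uIcc_of_le (by linarith)] at hf hf'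
  have hparts := intervalIntegral.integral_smul_deriv_eq_deriv_smul
    (u := fun y => bernoulliFun (N + 1) (y - a))
    (u' := fun y => ((N : ℝ) + 1) * bernoulliFun N (y - a))
    (fun y _ => by simpa using (hasDerivAt_bernoulliFun (N + 1) (y - a)).comp_sub_const y a) hf
    (Continuous.intervalIntegrable (by fun_prop) _ _) hf'.intervalIntegrable
  simpa only [add_sub_cancel_left, sub_self, mul_smul, intervalIntegral.integral_smul] using hparts

theorem eulerMaclaurin_unit
    (hf : ∀ i ≤ N, ∀ y ∈ Set.Icc a (a + 1), HasDerivAt (f i) (f (i + 1) y) y)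
    (hcont : ContinuousOn (f (N + 1)) (Set.Icc a (a + 1))) :
    f 0 a = (∫ y in a..a + 1, f 0 y)
      + (emBoundary (N + 1) f (a + 1) - emBoundary (N + 1) f a)
      + ((-1) ^ N / (N + 1).factorial : ℝ)
          • ∫ y in a..a + 1, bernoulliFun (N + 1) (y - a) • f (N + 1) y := by
  rw [integral_bernoulliFun_smul_deriv (hf N le_rfl) hcont]
  induction N with
  | zero =>
    simp only [zero_add, emBoundary_one, bernoulliFun_zero, one_smul, bernoulliFun_eval_one,
      bernoulliFun_eval_zero, bernoulli_one, if_true]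
    push_cast
    module
  | succ N ih =>
    have hprev := ih (fun i hi => hf i (by omega)) (HasDerivAt.continuousOn (hf (N + 1) le_rfl))
    rw [← integral_bernoulliFun_smul_deriv (hf N (by omega))
      (HasDerivAt.continuousOn (hf (N + 1) le_rfl))] at hprev
    have hfac : ((N + 1 + 1).factorial : ℝ) = (N + 2) * (N + 1).factorial := by
      rw [Nat.factorial_succ]; push_cast; ring
    rw [hprev, emBoundary_succ (N + 1), emBoundary_succ (N + 1),
      bernoulliFun_endpoints_eq_of_ne_one (by omega), ← neg_one_pow_mul_bernoulliFun_eval_zero]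
    rw [pow_succ, hfac]
    push_cast
    match_scalars <;> field_simp <;> ring

theorem exists_bound_eulerMaclaurin_unit (E : Type*) [NormedAddCommGroup E] [NormedSpace ℝ E]
    [CompleteSpace E] (N : ℕ) : ∃ K : ℝ, 0 ≤ K ∧ ∀ (f : ℕ → ℝ → E) (a C : ℝ),
      (∀ i ≤ N, ∀ y ∈ Set.Icc a (a + 1), HasDerivAt (f i) (f (i + 1) y) y) →
      ContinuousOn (f (N + 1)) (Set.Icc a (a + 1)) →
      (∀ y ∈ Set.Icc a (a + 1), ‖f (N + 1) y‖ ≤ C) →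
      ‖f 0 a - ((∫ y in a..a + 1, f 0 y)
        + (emBoundary (N + 1) f (a + 1) - emBoundary (N + 1) f a))‖ ≤ K * C := by
  obtain ⟨B, hB⟩ := isCompact_Icc.exists_bound_of_continuousOn
    (continuous_bernoulliFun (N + 1)).continuousOn (s := Set.Icc (0 : ℝ) 1)
  have hB0 : 0 ≤ B := (norm_nonneg _).trans (hB 0 (by simp))
  refine ⟨‖((-1) ^ N / (N + 1).factorial : ℝ)‖ * B, by positivity, fun f a C hf hcont hC => ?_⟩
  rw [eulerMaclaurin_unit hf hcont, add_sub_cancel_left, norm_smul, mul_assoc]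
  gcongr
  refine (intervalIntegral.norm_integral_le_of_norm_le_const (C := B * C) fun y hy => ?_).trans
    (by simp)
  rw [Set.uIoc_of_le (by linarith)] at hy
  rw [norm_smul]
  exact mul_le_mul (hB _ ⟨by linarith [hy.1], by linarith [hy.2]⟩) (hC y ⟨hy.1.le, hy.2⟩)
    (norm_nonneg _) hB0

theorem exists_bound_eulerMaclaurin (E : Type*) [NormedAddCommGroup E] [NormedSpace ℝ E]
    [CompleteSpace E] (N : ℕ) : ∃ K : ℝ, 0 ≤ K ∧ ∀ (f : ℕ → ℝ → E) (a : ℝ) (n : ℕ) (C : ℝ),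
      (∀ i ≤ N, ∀ y ∈ Set.Icc a (a + n), HasDerivAt (f i) (f (i + 1) y) y) →
      ContinuousOn (f (N + 1)) (Set.Icc a (a + n)) →
      (∀ y ∈ Set.Icc a (a + n), ‖f (N + 1) y‖ ≤ C) →
      ‖∑ k ∈ Finset.range n, f 0 (a + k) - ((∫ y in a..a + n, f 0 y)
        + (emBoundary (N + 1) f (a + n) - emBoundary (N + 1) f a))‖ ≤ K * (n * C) := by
  obtain ⟨K, hK, hunit⟩ := exists_bound_eulerMaclaurin_unit E N
  refine ⟨K, hK, fun f a n C hf hcont hC => ?_⟩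
  have hsub : ∀ k < n, Set.Icc (a + k) (a + k + 1) ⊆ Set.Icc a (a + n) := fun k hk =>
    have hkn : (k : ℝ) + 1 ≤ n := by exact_mod_cast hk
    Set.Icc_subset_Icc (by linarith [k.cast_nonneg (α := ℝ)]) (by linarith)
  have hintegral : ∑ k ∈ Finset.range n, ∫ y in a + k..a + k + 1, f 0 y
      = ∫ y in a..a + n, f 0 y := by
    have hcont₀ := HasDerivAt.continuousOn (hf 0 (Nat.zero_le N))
    simpa [add_assoc] using intervalIntegral.sum_integral_adjacent_intervals
      (a := fun k : ℕ => a + k) (f := f 0) fun k hk => by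
        refine (hcont₀.mono ?_).intervalIntegrable
        rw [Set.uIcc_of_le (by simp)]
        simpa [add_assoc] using hsub k hk
  have hboundary := Finset.sum_range_sub (fun k : ℕ => emBoundary (N + 1) f (a + k)) n
  push_cast at hboundary
  rw [add_zero] at hboundary
  rw [← hintegral, ← hboundary, ← Finset.sum_add_distrib, ← Finset.sum_sub_distrib]
  refine (norm_sum_le_of_le _ fun k hk => ?_).trans_eq
    (b := ∑ _k ∈ Finset.range n, K * C) (by simp; ring)
  have hk := hsub k (Finset.mem_range.1 hk)
  simpa only [add_assoc] using hunit f (a + k) C (fun i hi y hy => hf i hi y (hk hy))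
    (hcont.mono hk) fun y hy => hC y (hk hy)

end EulerMaclaurin

section LimitOfIncrements

theorem norm_sub_le_of_tendsto_of_norm_step_le {E : Type*} [NormedAddCommGroup E] {u : ℕ → E}
    {l : E} {C e : ℝ} (he : e ≤ -2) (hC : 0 ≤ C)
    (hstep : ∀ n : ℕ, 1 ≤ n → ‖u (n + 1) - u n‖ ≤ C * (n : ℝ) ^ e)
    (hl : Tendsto u atTop (𝓝 l)) {n : ℕ} (hn : 1 ≤ n) :
    ‖u n - l‖ ≤ C * (∑' m : ℕ, ((m : ℝ) + 1) ^ (-2 : ℝ)) * (n : ℝ) ^ (e + 2) := by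
  have hn_pos : (0 : ℝ) < n := by exact_mod_cast hn
  have hsummable : Summable fun m : ℕ => ((m : ℝ) + 1) ^ (-2 : ℝ) := by
    have h := (summable_nat_add_iff 1).2 (Real.summable_nat_rpow.2 (by norm_num : (-2 : ℝ) < -1))
    simpa only [Nat.cast_add, Nat.cast_one] using h
  have hshift : ∀ m : ℕ, dist (u (n + m)) (u (n + m.succ))
      ≤ C * (n : ℝ) ^ (e + 2) * ((m : ℝ) + 1) ^ (-2 : ℝ) := fun m => by
    have hm : (m : ℝ) + 1 ≤ (n + m : ℕ) := by
      push_cast; linarith [show (1 : ℝ) ≤ n by exact_mod_cast hn]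
    have hnm : (0 : ℝ) < (n + m : ℕ) := by positivity
    calc dist (u (n + m)) (u (n + m.succ)) ≤ C * ((n + m : ℕ) : ℝ) ^ e := by
          rw [dist_comm, dist_eq_norm]; exact hstep (n + m) (by omega)
      _ = C * (((n + m : ℕ) : ℝ) ^ (e + 2) * ((n + m : ℕ) : ℝ) ^ (-2 : ℝ)) := by
          rw [← Real.rpow_add hnm, add_neg_cancel_right]
      _ ≤ C * ((n : ℝ) ^ (e + 2) * ((m : ℝ) + 1) ^ (-2 : ℝ)) := by
          gcongr ?_ * (?_ * ?_)
          · exact Real.rpow_le_rpow_of_nonpos hn_pos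
              (by push_cast; linarith [m.cast_nonneg (α := ℝ)]) (by linarith)
          · exact Real.rpow_le_rpow_of_nonpos (by positivity) hm (by norm_num)
      _ = _ := by ring
  have htail := dist_le_tsum_of_dist_le_of_tendsto₀ _ hshift (hsummable.mul_left _)
    (hl.comp (tendsto_atTop_mono (fun m => Nat.le_add_left m n) tendsto_id))
  rw [tsum_mul_left, dist_eq_norm, add_zero] at htail
  exact htail.trans_eq (by ring)

theorem exists_differentiableOn_tendsto_of_norm_step_le {E : Type*} [NormedAddCommGroup E]
    [NormedSpace ℂ E] [CompleteSpace E] {F : ℕ → ℂ → E} {s : Set ℂ} {b : ℕ → ℝ} (hs : IsOpen s)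
    (hF : ∀ n, DifferentiableOn ℂ (F n) s) (hb : Summable b)
    (hstep : ∀ n, ∀ z ∈ s, ‖F (n + 1) z - F n z‖ ≤ b n) :
    ∃ G : ℂ → E, DifferentiableOn ℂ G s ∧ ∀ z ∈ s, Tendsto (F · z) atTop (𝓝 (G z)) := by
  refine ⟨fun z => F 0 z + ∑' n, (F (n + 1) z - F n z), (hF 0).add
    (Complex.differentiableOn_tsum_of_summable_norm hb (fun n => (hF (n + 1)).sub (hF n)) hs hstep),
    fun z hz => ?_⟩
  have hsum := (Summable.of_norm_bounded hb fun n => hstep n z hz).hasSum.tendsto_sum_nat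
  simpa only [Finset.sum_range_sub (F · z), add_sub_cancel] using hsum.const_add (F 0 z)

end LimitOfIncrements

section PowerSums

/-- The `i`-th derivative of the real function `y ↦ y ^ z` with complex exponent `z`. -/
noncomputable def cpowDeriv (z : ℂ) (i : ℕ) (y : ℝ) : ℂ :=
  (descPochhammer ℂ i).eval z * (y : ℂ) ^ (z - i)

/-- The power sum `∑_{k=1}^{n-1} k ^ z`. -/
noncomputable def powSum (z : ℂ) (n : ℕ) : ℂ := ∑ k ∈ Finset.Ico 1 n, (k : ℂ) ^ z

/-- The Euler–Maclaurin approximation of order `N` to the constant term of `powSum z n`, normalized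
by the integral from `1` so that it is entire in `z`. -/
noncomputable def zetaApprox (N n : ℕ) (z : ℂ) : ℂ :=
  powSum z n - (∫ y in (1 : ℝ)..n, (y : ℂ) ^ z) - emBoundary N (cpowDeriv z) n

theorem hasDerivAt_cpowDeriv (z : ℂ) (i : ℕ) {y : ℝ} (hy : 0 < y) :
    HasDerivAt (cpowDeriv z i) (cpowDeriv z (i + 1) y) y := by
  have h := (((hasDerivAt_id (y : ℂ)).cpow_const (c := z - i)
    (Complex.ofReal_mem_slitPlane.2 hy)).const_mul ((descPochhammer ℂ i).eval z)).comp_ofReal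
  refine h.congr_deriv ?_
  rw [cpowDeriv, descPochhammer_succ_eval, id, Nat.cast_succ, ← sub_sub]
  ring

theorem norm_cpowDeriv (z : ℂ) (i : ℕ) {y : ℝ} (hy : 0 < y) :
    ‖cpowDeriv z i y‖ = ‖(descPochhammer ℂ i).eval z‖ * y ^ (z.re - i) := by
  rw [cpowDeriv, norm_mul, Complex.norm_cpow_eq_rpow_re_of_pos hy, Complex.sub_re,
    Complex.natCast_re]

theorem cpowDeriv_zero (z : ℂ) (y : ℝ) : cpowDeriv z 0 y = (y : ℂ) ^ z := by simp [cpowDeriv]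

theorem exists_bound_eval_descPochhammer (i : ℕ) (R : ℝ) :
    ∃ C, 0 ≤ C ∧ ∀ z : ℂ, ‖z‖ ≤ R → ‖(descPochhammer ℂ i).eval z‖ ≤ C := by
  obtain ⟨C, hC⟩ := (isCompact_closedBall (0 : ℂ) R).exists_bound_of_continuousOn
    (descPochhammer ℂ i).continuous.continuousOn
  exact ⟨max C 0, le_max_right _ _,
    fun z hz => (hC z (mem_closedBall_zero_iff.2 hz)).trans (le_max_left _ _)⟩

theorem intervalIntegrable_ofReal_cpow {a b : ℝ} (ha : 0 < a) (hb : 0 < b) (z : ℂ) :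
    IntervalIntegrable (fun y : ℝ => (y : ℂ) ^ z) MeasureTheory.volume a b :=
  intervalIntegral.intervalIntegrable_cpow (Or.inr (Set.notMem_uIcc_of_lt ha hb))

theorem exists_bound_zetaApprox_step (N : ℕ) (R : ℝ) : ∃ C, 0 ≤ C ∧ ∀ (z : ℂ) (n : ℕ),
    ‖z‖ ≤ R → z.re ≤ N + 1 → 1 ≤ n →
      ‖zetaApprox (N + 1) (n + 1) z - zetaApprox (N + 1) n z‖ ≤ C * (n : ℝ) ^ (z.re - (N + 1)) := by
  obtain ⟨K, hK, hem⟩ := exists_bound_eulerMaclaurin ℂ N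
  obtain ⟨D, hD, hdesc⟩ := exists_bound_eval_descPochhammer (N + 1) R
  refine ⟨K * D, by positivity, fun z n hz hre hn => ?_⟩
  have hn_pos : (0 : ℝ) < n := by exact_mod_cast hn
  have hderiv : ∀ i, ∀ y ∈ Set.Icc (n : ℝ) (n + (1 : ℕ)),
      HasDerivAt (cpowDeriv z i) (cpowDeriv z (i + 1) y) y :=
    fun i y hy => hasDerivAt_cpowDeriv z i (hn_pos.trans_le hy.1)
  have hunit := hem (cpowDeriv z) n 1 (D * (n : ℝ) ^ (z.re - (N + 1))) (fun i _ => hderiv i)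
    (HasDerivAt.continuousOn (hderiv (N + 1))) fun y hy => by
      rw [norm_cpowDeriv z _ (hn_pos.trans_le hy.1)]
      refine mul_le_mul (hdesc z hz) ?_ (Real.rpow_nonneg (hn_pos.le.trans hy.1) _) hD
      push_cast
      exact Real.rpow_le_rpow_of_nonpos hn_pos hy.1 (by linarith)
  have hintegral := intervalIntegral.integral_add_adjacent_intervals
    (intervalIntegrable_ofReal_cpow one_pos hn_pos z)
    (intervalIntegrable_ofReal_cpow hn_pos (b := (n + 1 : ℕ)) (by positivity) z)
  have hsum : powSum z (n + 1) = powSum z n + (n : ℂ) ^ z := Finset.sum_Ico_succ_top hn _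
  rw [zetaApprox, zetaApprox, hsum, ← hintegral]
  simp only [Finset.range_one, Finset.sum_singleton, cpowDeriv_zero, Nat.cast_zero, add_zero,
    Complex.ofReal_natCast, Nat.cast_one, one_mul] at hunit
  rw [mul_assoc]
  refine (le_of_eq ?_).trans hunit
  push_cast
  congr 1
  ring

theorem integral_one_ofReal_cpow {n : ℕ} (hn : 1 ≤ n) {z : ℂ} (hz : z ≠ -1) :
    ∫ y in (1 : ℝ)..n, (y : ℂ) ^ z = ((n : ℂ) ^ (z + 1) - 1) / (z + 1) := by
  rw [integral_cpow (Or.inr ⟨hz, Set.notMem_uIcc_of_lt one_pos (by exact_mod_cast hn)⟩)]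
  simp

theorem integral_one_ofReal_cpow_neg_one {n : ℕ} (hn : 1 ≤ n) :
    ∫ y in (1 : ℝ)..n, (y : ℂ) ^ (-1 : ℂ) = Real.log n := by
  have h : ∀ y : ℝ, (y : ℂ) ^ (-1 : ℂ) = ((1 / y : ℝ) : ℂ) := fun y => by
    rw [Complex.cpow_neg_one, one_div, Complex.ofReal_inv]
  simp_rw [h]
  rw [intervalIntegral.integral_ofReal, integral_one_div_of_pos one_pos (by exact_mod_cast hn),
    div_one]

theorem differentiable_natCast_cpow {n : ℕ} (hn : 1 ≤ n) :
    Differentiable ℂ fun z : ℂ => (n : ℂ) ^ z :=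
  differentiable_id.const_cpow (Or.inl (by exact_mod_cast (by omega : n ≠ 0)))

theorem differentiable_integral_one_ofReal_cpow {n : ℕ} (hn : 1 ≤ n) :
    Differentiable ℂ fun z : ℂ => ∫ y in (1 : ℝ)..n, (y : ℂ) ^ z := by
  have hdslope : (fun z : ℂ => ∫ y in (1 : ℝ)..n, (y : ℂ) ^ z)
      = fun z => dslope (fun w : ℂ => (n : ℂ) ^ w) 0 (z + 1) := funext fun z => by
    have hn₀ : (n : ℂ) ≠ 0 := by exact_mod_cast (by omega : n ≠ 0)
    rcases eq_or_ne z (-1) with rfl | hz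
    · rw [integral_one_ofReal_cpow_neg_one hn, neg_add_cancel, dslope_same,
        ((hasDerivAt_id' (0 : ℂ)).const_cpow (Or.inl hn₀)).deriv]
      simp [Complex.natCast_log]
    · rw [integral_one_ofReal_cpow hn hz, dslope_of_ne _ (by rwa [Ne, add_eq_zero_iff_eq_neg]),
        slope_def_field]
      simp
  rw [hdslope]
  have hentire : Differentiable ℂ (dslope (fun w : ℂ => (n : ℂ) ^ w) 0) := by
    rw [← differentiableOn_univ, Complex.differentiableOn_dslope univ_mem]
    exact (differentiable_natCast_cpow hn).differentiableOn
  fun_prop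

theorem differentiable_zetaApprox (N : ℕ) {n : ℕ} (hn : 1 ≤ n) :
    Differentiable ℂ (zetaApprox N n) := by
  unfold zetaApprox powSum emBoundary cpowDeriv
  refine (Differentiable.sub ?_ (differentiable_integral_one_ofReal_cpow hn)).sub ?_
  · exact Differentiable.fun_sum fun k hk =>
      differentiable_natCast_cpow (Finset.mem_Ico.1 hk).1
  · refine Differentiable.fun_sum fun i _ => Differentiable.const_smul
      ((descPochhammer ℂ i).differentiable.mul ?_) _
    exact (differentiable_natCast_cpow hn).comp (differentiable_id.sub_const _)

theorem tendsto_powSum {z : ℂ} (hz : z.re < -1) :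
    Tendsto (powSum z) atTop (𝓝 (riemannZeta (-z))) := by
  have hs : 1 < (-z).re := by simpa using by linarith
  have hsummable : Summable fun k : ℕ => 1 / ((k : ℂ) + 1) ^ (-z) := by
    simpa using (summable_nat_add_iff 1).2 (Complex.summable_one_div_nat_cpow.2 hs)
  rw [zeta_eq_tsum_one_div_nat_add_one_cpow hs, ← tendsto_add_atTop_iff_nat 1]
  refine hsummable.hasSum.tendsto_sum_nat.congr fun n => ?_
  rw [powSum, Finset.sum_Ico_eq_sum_range, Nat.add_sub_cancel]
  refine Finset.sum_congr rfl fun k _ => ?_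
  rw [Complex.cpow_neg, one_div, inv_inv, add_comm]
  push_cast
  rfl

theorem tendsto_natCast_cpow_zero {z : ℂ} (hz : z.re < 0) :
    Tendsto (fun n : ℕ => (n : ℂ) ^ z) atTop (𝓝 0) := by
  rw [tendsto_zero_iff_norm_tendsto_zero]
  have h := (tendsto_rpow_neg_atTop (y := -z.re) (by linarith)).comp tendsto_natCast_atTop_atTop
  rw [neg_neg] at h
  refine h.congr' ?_
  filter_upwards [eventually_ge_atTop 1] with n hn
  exact (Complex.norm_natCast_cpow_of_pos hn z).symm

theorem zetaApprox_sub_riemannZeta₀ {N n : ℕ} (hn : 1 ≤ n) {z : ℂ} (hz : z ≠ -1) :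
    zetaApprox N n z - riemannZeta₀ (-z) = powSum z n - (n : ℂ) ^ (z + 1) / (z + 1)
      - emBoundary N (cpowDeriv z) n - riemannZeta (-z) := by
  have hinv : (-z - 1)⁻¹ = -(1 / (z + 1)) := by rw [← neg_add', inv_neg, one_div]
  rw [zetaApprox, integral_one_ofReal_cpow hn hz,
    riemannZeta_eq_inv_sub_add (fun h => hz (neg_eq_iff_eq_neg.1 h)), hinv, sub_div]
  ring

theorem tendsto_zetaApprox_of_re_lt (N : ℕ) {z : ℂ} (hz : z.re < -1) :
    Tendsto (zetaApprox N · z) atTop (𝓝 (riemannZeta₀ (-z))) := by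
  have hboundary : Tendsto (fun n : ℕ => emBoundary N (cpowDeriv z) n) atTop (𝓝 0) := by
    unfold emBoundary cpowDeriv
    have h := tendsto_finsetSum (Finset.range N) fun i _ =>
      ((tendsto_natCast_cpow_zero (z := z - i) (by
        simpa using by linarith [i.cast_nonneg (α := ℝ)])).const_mul
          ((descPochhammer ℂ i).eval z)).const_smul (emCoeff i)
    simpa using h
  have hcpow := (tendsto_natCast_cpow_zero (z := z + 1) (by simpa using by linarith)).div_const
    (z + 1)
  have hdiff := (((tendsto_powSum hz).sub hcpow).sub hboundary).sub_const (riemannZeta (-z))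
  have hz₁ : z ≠ -1 := by rintro rfl; simp at hz
  rw [← tendsto_sub_nhds_zero_iff]
  refine Tendsto.congr' ?_ (hdiff.trans (by simp))
  filter_upwards [eventually_ge_atTop 1] with n hn
  exact (zetaApprox_sub_riemannZeta₀ hn hz₁).symm

theorem tendsto_zetaApprox {N : ℕ} {z : ℂ} (hz : ‖z‖ + 3 ≤ N) :
    Tendsto (zetaApprox (N + 1) · z) atTop (𝓝 (riemannZeta₀ (-z))) := by
  set s : Set ℂ := Metric.ball 0 (N - 1) with hs
  have hN : (3 : ℝ) ≤ N := by linarith [norm_nonneg z]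
  obtain ⟨C, hC, hstep⟩ := exists_bound_zetaApprox_step N (N - 1)
  have hsummable : Summable fun n : ℕ => C * ((n + 1 : ℕ) : ℝ) ^ (-2 : ℝ) :=
    ((summable_nat_add_iff 1).2 (Real.summable_nat_rpow.2 (by norm_num))).mul_left C
  obtain ⟨G, hG, hlim⟩ := exists_differentiableOn_tendsto_of_norm_step_le
    (F := fun n => zetaApprox (N + 1) (n + 1)) (s := s) Metric.isOpen_ball
    (fun n => (differentiable_zetaApprox _ (by omega)).differentiableOn) hsummable
    fun n w hw => by
      rw [hs, mem_ball_zero_iff] at hw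
      have hre := (Complex.re_le_norm w).trans_lt hw
      refine (hstep w (n + 1) hw.le (by linarith) (by omega)).trans ?_
      gcongr
      · exact_mod_cast Nat.le_add_left 1 n
      · linarith
  have hζ : DifferentiableOn ℂ (fun w => riemannZeta₀ (-w)) s :=
    Differentiable.differentiableOn (by fun_prop)
  have hbase : (-3 / 2 : ℂ) ∈ s := by
    rw [hs, mem_ball_zero_iff, norm_div, norm_neg]
    norm_num
    linarith
  have hlocal : G =ᶠ[𝓝 (-3 / 2)] fun w => riemannZeta₀ (-w) := by
    have hhalf : {w : ℂ | w.re < -1} ∈ 𝓝 (-3 / 2 : ℂ) :=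
      (isOpen_lt Complex.continuous_re continuous_const).mem_nhds (by norm_num)
    filter_upwards [hhalf, Metric.isOpen_ball.mem_nhds hbase] with w hw hws
    exact tendsto_nhds_unique (hlim w hws)
      ((tendsto_add_atTop_iff_nat 1).2 (tendsto_zetaApprox_of_re_lt (N + 1) hw))
  have heq := (hG.analyticOnNhd Metric.isOpen_ball).eqOn_of_preconnected_of_eventuallyEq
    (hζ.analyticOnNhd Metric.isOpen_ball) (convex_ball _ _).isPreconnected hbase hlocal
  have hzs : z ∈ s := by rw [hs, mem_ball_zero_iff]; linarith
  rw [← tendsto_add_atTop_iff_nat 1]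
  simpa only [heq hzs] using hlim z hzs

theorem isBigO_cpowDeriv (i : ℕ) (R : ℝ) :
    (fun x : ℕ × ℂ => cpowDeriv x.2 i x.1) =O[atTop ×ˢ 𝓟 (Metric.closedBall 0 R)]
      fun x => (x.1 : ℝ) ^ (x.2.re - i) := by
  obtain ⟨D, -, hdesc⟩ := exists_bound_eval_descPochhammer i R
  refine .of_bound D (eventually_prod_principal_iff.2 ?_)
  filter_upwards [eventually_ge_atTop 1] with n hn z hz
  rw [norm_cpowDeriv z i (by exact_mod_cast hn), Real.norm_of_nonneg (by positivity)]
  gcongr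
  exact hdesc z (mem_closedBall_zero_iff.1 hz)

theorem isBigO_rpow_re_sub {s : Set ℂ} {a b : ℝ} (hab : a ≤ b) :
    (fun x : ℕ × ℂ => (x.1 : ℝ) ^ (x.2.re - b)) =O[atTop ×ˢ 𝓟 s]
      fun x => (x.1 : ℝ) ^ (x.2.re - a) := by
  refine .of_bound' (eventually_prod_principal_iff.2 ?_)
  filter_upwards [eventually_ge_atTop 1] with n hn z _
  rw [Real.norm_of_nonneg (by positivity), Real.norm_of_nonneg (by positivity)]
  exact Real.rpow_le_rpow_of_exponent_le (by exact_mod_cast hn) (by linarith)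

theorem isBigO_zetaApprox_sub (N : ℕ) (R : ℝ) :
    (fun x : ℕ × ℂ => zetaApprox N x.1 x.2 - riemannZeta₀ (-x.2))
      =O[atTop ×ˢ 𝓟 (Metric.closedBall 0 R)] fun x => (x.1 : ℝ) ^ (x.2.re - N) := by
  obtain ⟨Q, hNQ, hRQ⟩ : ∃ Q : ℕ, N + 1 ≤ Q ∧ R + 3 ≤ Q :=
    ⟨max (N + 1) ⌈R + 3⌉₊, le_max_left _ _,
      (Nat.le_ceil _).trans (by exact_mod_cast le_max_right _ _)⟩
  obtain ⟨C, hC, hstep⟩ := exists_bound_zetaApprox_step Q R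
  have hhigh : (fun x : ℕ × ℂ => zetaApprox (Q + 1) x.1 x.2 - riemannZeta₀ (-x.2))
      =O[atTop ×ˢ 𝓟 (Metric.closedBall 0 R)] fun x => (x.1 : ℝ) ^ (x.2.re - N) := by
    refine .of_bound (C * ∑' m : ℕ, ((m : ℝ) + 1) ^ (-2 : ℝ)) (eventually_prod_principal_iff.2 ?_)
    filter_upwards [eventually_ge_atTop 1] with n hn z hz
    rw [mem_closedBall_zero_iff] at hz
    have hre := (Complex.re_le_norm z).trans hz
    refine (norm_sub_le_of_tendsto_of_norm_step_le (u := (zetaApprox (Q + 1) · z)) (by linarith) hC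
      (fun m hm => hstep z m hz (by linarith) hm) (tendsto_zetaApprox (by linarith)) hn).trans ?_
    rw [Real.norm_of_nonneg (by positivity)]
    gcongr
    · exact_mod_cast hn
    · linarith [show (N : ℝ) + 1 ≤ Q by exact_mod_cast hNQ]
  have hextra : (fun x : ℕ × ℂ => ∑ i ∈ Finset.Ico N (Q + 1), emCoeff i • cpowDeriv x.2 i x.1)
      =O[atTop ×ˢ 𝓟 (Metric.closedBall 0 R)] fun x => (x.1 : ℝ) ^ (x.2.re - N) :=
    .fun_sum fun i hi => (IsBigO.const_smul_self (emCoeff i)).trans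
      ((isBigO_cpowDeriv i R).trans (isBigO_rpow_re_sub (Nat.cast_le.2 (Finset.mem_Ico.1 hi).1)))
  refine (hhigh.add hextra).congr_left fun x => ?_
  rw [Finset.sum_Ico_eq_sub _ (by omega), zetaApprox, zetaApprox, emBoundary, emBoundary]
  ring

end PowerSums

section ComplexHarmonic

/-- The harmonic number `∑_{l ≥ 1} (1 / l - 1 / (a + l))` of complex index `a`; the series is used
for `-1 / 2 ≤ a.re` only. -/
noncomputable def complexHarmonic (a : ℂ) : ℂ :=
  ∑' l : ℕ, (((l : ℂ) + 1)⁻¹ - (a + (l + 1))⁻¹)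

theorem half_le_norm_add_natCast_succ {a : ℂ} (ha : -1 / 2 ≤ a.re) (l : ℕ) :
    ((l : ℝ) + 1) / 2 ≤ ‖a + (l + 1)‖ := by
  refine le_trans ?_ (Complex.re_le_norm _)
  simp only [Complex.add_re, Complex.natCast_re, Complex.one_re]
  linarith [l.cast_nonneg (α := ℝ)]

theorem add_natCast_succ_ne_zero {a : ℂ} (ha : -1 / 2 ≤ a.re) (l : ℕ) : a + (l + 1) ≠ 0 :=
  norm_pos_iff.1 (lt_of_lt_of_le (by positivity) (half_le_norm_add_natCast_succ ha l))

theorem norm_inv_sub_inv_add_le {a : ℂ} (ha : -1 / 2 ≤ a.re) (l : ℕ) :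
    ‖((l : ℂ) + 1)⁻¹ - (a + (l + 1))⁻¹‖ ≤ 2 * ‖a‖ * (((l : ℝ) + 1) ^ 2)⁻¹ := by
  have hl : (l : ℂ) + 1 ≠ 0 := Nat.cast_add_one_ne_zero l
  have hnorm : ‖(l : ℂ) + 1‖ = l + 1 := by exact_mod_cast Complex.norm_natCast (l + 1)
  rw [inv_sub_inv hl (add_natCast_succ_ne_zero ha l), add_sub_cancel_right, norm_div, norm_mul,
    hnorm]
  calc ‖a‖ / ((l + 1) * ‖a + (l + 1)‖) ≤ ‖a‖ / ((l + 1) * (((l : ℝ) + 1) / 2)) := by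
        gcongr; exact half_le_norm_add_natCast_succ ha l
    _ = 2 * ‖a‖ * (((l : ℝ) + 1) ^ 2)⁻¹ := by field_simp

theorem summable_inv_succ_pow {k : ℕ} (hk : 1 < k) :
    Summable fun l : ℕ => (((l : ℝ) + 1) ^ k)⁻¹ := by
  simpa using (summable_nat_add_iff 1).2 (Real.summable_nat_pow_inv.2 hk)

theorem summable_complexHarmonic {a : ℂ} (ha : -1 / 2 ≤ a.re) :
    Summable fun l : ℕ => ((l : ℂ) + 1)⁻¹ - (a + (l + 1))⁻¹ :=
  .of_norm_bounded ((summable_inv_succ_pow one_lt_two).mul_left _) (norm_inv_sub_inv_add_le ha)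

theorem complexHarmonic_zero : complexHarmonic 0 = 0 := by simp [complexHarmonic]

theorem complexHarmonic_add_one {a : ℂ} (ha : -1 / 2 ≤ a.re) :
    complexHarmonic (a + 1) = complexHarmonic a + (a + 1)⁻¹ := by
  have ha₁ : -1 / 2 ≤ (a + 1).re := by simp only [Complex.add_re, Complex.one_re]; linarith
  have hpartial : ∀ M : ℕ, ∑ l ∈ Finset.range M, (((l : ℂ) + 1)⁻¹ - (a + 1 + (l + 1))⁻¹)
      = ∑ l ∈ Finset.range M, (((l : ℂ) + 1)⁻¹ - (a + (l + 1))⁻¹)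
        + ((a + 1)⁻¹ - (a + (M + 1))⁻¹) := fun M => by
    have htelescope := Finset.sum_range_sub' (fun l : ℕ => (a + (l + 1))⁻¹) M
    rw [Nat.cast_zero, zero_add] at htelescope
    rw [← htelescope, ← Finset.sum_add_distrib]
    exact Finset.sum_congr rfl fun l _ => by push_cast; ring
  have hvanish : Tendsto (fun M : ℕ => (a + ((M : ℂ) + 1))⁻¹) atTop (𝓝 0) := by
    refine squeeze_zero_norm (fun M => ?_)
      ((mul_zero (2 : ℝ)) ▸ (tendsto_one_div_add_atTop_nhds_zero_nat (𝕜 := ℝ)).const_mul 2)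
    rw [norm_inv, mul_one_div, ← inv_div]
    exact inv_anti₀ (by positivity) (half_le_norm_add_natCast_succ ha M)
  have hlim := (summable_complexHarmonic ha).hasSum.tendsto_sum_nat.add
    (hvanish.const_sub (a + 1)⁻¹)
  rw [sub_zero] at hlim
  exact tendsto_nhds_unique (summable_complexHarmonic ha₁).hasSum.tendsto_sum_nat
    (hlim.congr fun M => (hpartial M).symm)

theorem neg_half_lt_re_of_mem_ball {a : ℂ} (ha : a ∈ Metric.ball (0 : ℂ) (1 / 2)) :
    -1 / 2 < a.re := by
  rw [mem_ball_zero_iff] at ha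
  linarith [(abs_le.1 (Complex.abs_re_le_norm a)).1]

theorem differentiableOn_inv_sub_inv_add (l : ℕ) :
    DifferentiableOn ℂ (fun a : ℂ => ((l : ℂ) + 1)⁻¹ - (a + (l + 1))⁻¹)
      (Metric.ball 0 (1 / 2)) := fun a ha => by
  have hne := add_natCast_succ_ne_zero (neg_half_lt_re_of_mem_ball ha).le l
  exact DifferentiableAt.differentiableWithinAt (by fun_prop (disch := exact hne))

theorem differentiableOn_complexHarmonic :
    DifferentiableOn ℂ complexHarmonic (Metric.ball 0 (1 / 2)) := by
  refine Complex.differentiableOn_tsum_of_summable_norm (summable_inv_succ_pow one_lt_two)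
    differentiableOn_inv_sub_inv_add Metric.isOpen_ball fun l a ha => ?_
  refine (norm_inv_sub_inv_add_le (neg_half_lt_re_of_mem_ball ha).le l).trans ?_
  rw [mem_ball_zero_iff] at ha
  exact mul_le_of_le_one_left (by positivity) (by linarith)

theorem contDiffAt_of_differentiableOn_ball {E : Type*} [NormedAddCommGroup E] [NormedSpace ℂ E]
    [CompleteSpace E] {f : ℂ → E} {x : ℂ} {R : ℝ} (hR : 0 < R)
    (hf : DifferentiableOn ℂ f (Metric.ball x R)) (k : WithTop ℕ∞) : ContDiffAt ℂ k f x :=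
  (hf.analyticAt (Metric.ball_mem_nhds x hR)).contDiffAt

theorem iteratedDeriv_inv_add (k : ℕ) (b : ℂ) :
    iteratedDeriv k (fun a : ℂ => (a + b)⁻¹) =
      fun a => (-1) ^ k * k.factorial * ((a + b) ^ (k + 1))⁻¹ := by
  have h := iter_deriv_inv_linear k (1 : ℂ) b
  simp only [one_mul, one_pow, mul_one] at h
  rw [iteratedDeriv_eq_iterate, h]
  ext a
  rw [← neg_add', zpow_neg, add_comm 1]
  norm_cast

theorem iteratedDeriv_const_sub_inv_add {k : ℕ} (hk : 0 < k) (b c : ℂ) :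
    iteratedDeriv k (fun a : ℂ => c - (a + b)⁻¹) =
      fun a => -((-1) ^ k * k.factorial * ((a + b) ^ (k + 1))⁻¹) := by
  ext a
  rw [iteratedDeriv_const_sub hk, iteratedDeriv_neg, iteratedDeriv_inv_add]

theorem summableLocallyUniformlyOn_iteratedDerivWithin_complexHarmonic {k : ℕ} (hk : 0 < k) :
    SummableLocallyUniformlyOn (fun l : ℕ => iteratedDerivWithin k
      (fun a : ℂ => ((l : ℂ) + 1)⁻¹ - (a + (l + 1))⁻¹) (Metric.ball 0 (1 / 2)))
      (Metric.ball 0 (1 / 2)) := by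
  refine SummableLocallyUniformlyOn_of_locally_bounded Metric.isOpen_ball fun K hK _ =>
    ⟨_, (summable_inv_succ_pow (by omega : 1 < k + 1)).mul_left
      ((k.factorial : ℝ) * 2 ^ (k + 1)),
      fun l a ha => ?_⟩
  rw [iteratedDerivWithin_of_isOpen Metric.isOpen_ball (hK ha), iteratedDeriv_const_sub_inv_add hk]
  have hhalf := half_le_norm_add_natCast_succ (neg_half_lt_re_of_mem_ball (hK ha)).le l
  simp only [norm_neg, norm_mul, norm_pow, norm_one, one_pow, one_mul, norm_inv,
    Complex.norm_natCast]
  calc k.factorial * (‖a + (l + 1)‖ ^ (k + 1))⁻¹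
      ≤ k.factorial * ((((l : ℝ) + 1) / 2) ^ (k + 1))⁻¹ := by gcongr
    _ = k.factorial * 2 ^ (k + 1) * (((l : ℝ) + 1) ^ (k + 1))⁻¹ := by rw [div_pow]; field_simp

theorem iteratedDeriv_complexHarmonic_zero {r : ℕ} (hr : 0 < r) :
    iteratedDeriv r complexHarmonic 0 = -((-1) ^ r * r.factorial * riemannZeta (r + 1)) := by
  have hzero : (0 : ℂ) ∈ Metric.ball (0 : ℂ) (1 / 2) := by simp
  have hopen : IsOpen (Metric.ball (0 : ℂ) (1 / 2)) := Metric.isOpen_ball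
  have htermwise := iteratedDerivWithin_tsum r hopen hzero
    (fun a ha => summable_complexHarmonic (neg_half_lt_re_of_mem_ball ha).le)
    (fun k hk _ => summableLocallyUniformlyOn_iteratedDerivWithin_complexHarmonic hk)
    fun l k a _ ha => (((differentiableOn_inv_sub_inv_add l).contDiffOn (n := ⊤)
      hopen).differentiableOn_iteratedDerivWithin (by simp)
      hopen.uniqueDiffOn).differentiableAt (hopen.mem_nhds ha)
  have hζ : riemannZeta (r + 1) = ∑' l : ℕ, (((0 : ℂ) + (l + 1)) ^ (r + 1))⁻¹ := by
    rw [zeta_eq_tsum_one_div_nat_add_one_cpow (by simpa using hr)]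
    refine tsum_congr fun l => ?_
    rw [zero_add, one_div]
    exact_mod_cast congrArg Inv.inv (Complex.cpow_natCast ((l : ℂ) + 1) (r + 1))
  rw [hζ, ← iteratedDerivWithin_of_isOpen hopen hzero, ← tsum_mul_left, ← tsum_neg]
  refine htermwise.trans (tsum_congr fun l => ?_)
  rw [iteratedDerivWithin_of_isOpen hopen hzero, iteratedDeriv_const_sub_inv_add hr]

end ComplexHarmonic

section ComplexHarmonicIntegral

variable {a : ℂ} {s : ℝ}

theorem norm_ofReal_cpow_le_one {z : ℂ} (hz : 0 ≤ z.re) (hs : s ∈ Set.Icc (0 : ℝ) 1) :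
    ‖(s : ℂ) ^ z‖ ≤ 1 := by
  refine (Complex.norm_cpow_le _ _).trans ?_
  rw [Complex.arg_ofReal_of_nonneg hs.1, zero_mul, Real.exp_zero, div_one, Complex.norm_real,
    Real.norm_of_nonneg hs.1]
  exact Real.rpow_le_one hs.1 hs.2 hz

theorem integral_affine_cpow (ha : 0 < a.re) (hs : s ≠ 1) {T : ℝ} (hT : T ≠ 0) :
    ∫ y in (0 : ℝ)..T, a * ((s + (1 - s) / T * y : ℝ) : ℂ) ^ (a - 1)
      = T * ((1 - (s : ℂ) ^ a) / (1 - s)) := by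
  have hne : (1 - s) / T ≠ 0 := div_ne_zero (sub_ne_zero.2 hs.symm) hT
  have ha₀ : a ≠ 0 := by rintro rfl; simp at ha
  have hs' : (1 : ℂ) - s ≠ 0 := by exact_mod_cast sub_ne_zero.2 hs.symm
  have hT' : (T : ℂ) ≠ 0 := by exact_mod_cast hT
  rw [intervalIntegral.integral_const_mul, intervalIntegral.integral_comp_add_mul
    (fun x : ℝ => (x : ℂ) ^ (a - 1)) hne, div_mul_cancel₀ _ hT, mul_zero, add_zero,
    add_sub_cancel, integral_cpow (Or.inl (by simpa using ha)), sub_add_cancel, Complex.ofReal_one,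
    Complex.one_cpow, Complex.real_smul]
  push_cast
  field_simp

theorem norm_one_sub_cpow_div_le (ha : 1 ≤ a.re) (hs : s ∈ Set.Icc (0 : ℝ) 1) :
    ‖(1 - (s : ℂ) ^ a) / (1 - s)‖ ≤ ‖a‖ := by
  rcases eq_or_ne s 1 with rfl | hs₁
  · simp
  have h := integral_affine_cpow (a := a) (by linarith) hs₁ one_ne_zero
  rw [Complex.ofReal_one, one_mul] at h
  rw [← h]
  refine (intervalIntegral.norm_integral_le_of_norm_le_const (C := ‖a‖) fun u hu => ?_).trans
    (by simp)
  rw [Set.uIoc_of_le zero_le_one] at hu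
  have hmem : s + (1 - s) / 1 * u ∈ Set.Icc (0 : ℝ) 1 := by
    rw [div_one]
    constructor <;> nlinarith [hu.1, hu.2, hs.1, hs.2]
  rw [norm_mul]
  exact mul_le_of_le_one_right (norm_nonneg _)
    (norm_ofReal_cpow_le_one (by simpa using ha) hmem)

theorem intervalIntegrable_one_sub_cpow_div (ha : 1 ≤ a.re) :
    IntervalIntegrable (fun s : ℝ => (1 - (s : ℂ) ^ a) / (1 - s)) MeasureTheory.volume 0 1 := by
  rw [intervalIntegrable_iff_integrableOn_Ioc_of_le zero_le_one]
  refine MeasureTheory.Measure.integrableOn_of_bounded (M := ‖a‖) (by simp) ?_ ?_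
  · exact (Measurable.div (by fun_prop) (by fun_prop)).aestronglyMeasurable
  · exact (MeasureTheory.ae_restrict_iff' measurableSet_Ioc).2
      (.of_forall fun s hs => norm_one_sub_cpow_div_le ha (Set.Ioc_subset_Icc_self hs))

theorem integral_pow_mul_one_sub_cpow (ha : 0 ≤ a.re) (l : ℕ) :
    ∫ s in (0 : ℝ)..1, (s : ℂ) ^ l * (1 - (s : ℂ) ^ a) = ((l : ℂ) + 1)⁻¹ - (a + (l + 1))⁻¹ := by
  have hre : -1 < (a + l).re := by simp; linarith [l.cast_nonneg (α := ℝ)]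
  have hne : a + (l + 1) ≠ 0 := add_natCast_succ_ne_zero (by linarith) l
  have hexpand : ∀ s ∈ Set.uIoc (0 : ℝ) 1,
      (s : ℂ) ^ l * (1 - (s : ℂ) ^ a) = (s : ℂ) ^ l - (s : ℂ) ^ (a + l) := fun s hs => by
    rw [Set.uIoc_of_le zero_le_one] at hs
    rw [Complex.cpow_add _ _ (by exact_mod_cast hs.1.ne'), Complex.cpow_natCast]
    ring
  rw [intervalIntegral.integral_congr_ae (.of_forall hexpand), intervalIntegral.integral_sub
    (Continuous.intervalIntegrable (by fun_prop) _ _)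
    (intervalIntegral.intervalIntegrable_cpow' hre), integral_cpow (Or.inl hre)]
  have hpow : ∫ s in (0 : ℝ)..1, (s : ℂ) ^ l = ((l : ℂ) + 1)⁻¹ := by
    have h := integral_cpow (a := 0) (b := 1) (r := l) (Or.inl (by simp; linarith))
    simpa [Complex.zero_cpow (Nat.cast_add_one_ne_zero l)] using h
  rw [hpow, add_assoc, Complex.ofReal_one, Complex.one_cpow, Complex.ofReal_zero,
    Complex.zero_cpow hne, sub_zero, one_div]

theorem one_sub_cpow_div_eq_sum_add (a : ℂ) (s : ℝ) (M : ℕ) :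
    (1 - (s : ℂ) ^ a) / (1 - s) = ∑ l ∈ Finset.range M, (s : ℂ) ^ l * (1 - (s : ℂ) ^ a)
      + (s : ℂ) ^ M * ((1 - (s : ℂ) ^ a) / (1 - s)) := by
  rcases eq_or_ne s 1 with rfl | hs
  · simp
  have hs' : (1 : ℂ) - s ≠ 0 := by exact_mod_cast sub_ne_zero.2 hs.symm
  rw [← Finset.sum_mul, geom_sum_eq (by exact_mod_cast hs), ← neg_div_neg_eq ((s : ℂ) ^ M - 1)]
  simp only [neg_sub]
  field_simp
  ring

theorem norm_integral_pow_mul_one_sub_cpow_div_le (ha : 1 ≤ a.re) (M : ℕ) :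
    ‖∫ s in (0 : ℝ)..1, (s : ℂ) ^ M * ((1 - (s : ℂ) ^ a) / (1 - s))‖ ≤ ‖a‖ * (1 / (M + 1)) := by
  calc _ ≤ ∫ s in (0 : ℝ)..1, s ^ M * ‖a‖ := by
        refine intervalIntegral.norm_integral_le_of_norm_le zero_le_one (.of_forall fun s hs => ?_)
          (Continuous.intervalIntegrable (by fun_prop) _ _)
        rw [norm_mul, norm_pow, Complex.norm_real, Real.norm_of_nonneg hs.1.le]
        gcongr
        · exact pow_nonneg hs.1.le _
        · exact norm_one_sub_cpow_div_le ha (Set.Ioc_subset_Icc_self hs)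
    _ = ‖a‖ * (1 / (M + 1)) := by
        rw [intervalIntegral.integral_mul_const, integral_pow]; simp [mul_comm]

theorem integral_one_sub_cpow_div (ha : 1 ≤ a.re) :
    ∫ s in (0 : ℝ)..1, (1 - (s : ℂ) ^ a) / (1 - s) = complexHarmonic a := by
  have hcont : Continuous fun s : ℝ => (s : ℂ) ^ a :=
    Complex.continuous_ofReal_cpow_const (by linarith)
  have hpartial : ∀ M : ℕ, (∫ s in (0 : ℝ)..1, (1 - (s : ℂ) ^ a) / (1 - s))
      - ∫ s in (0 : ℝ)..1, (s : ℂ) ^ M * ((1 - (s : ℂ) ^ a) / (1 - s))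
      = ∑ l ∈ Finset.range M, (((l : ℂ) + 1)⁻¹ - (a + (l + 1))⁻¹) := fun M => by
    have hrem : IntervalIntegrable (fun s : ℝ => (s : ℂ) ^ M * ((1 - (s : ℂ) ^ a) / (1 - s)))
        MeasureTheory.volume 0 1 :=
      (intervalIntegrable_one_sub_cpow_div ha).continuousOn_mul (by fun_prop)
    rw [← intervalIntegral.integral_sub (intervalIntegrable_one_sub_cpow_div ha) hrem]
    simp_rw [sub_eq_iff_eq_add.2 (one_sub_cpow_div_eq_sum_add a _ M)]
    rw [intervalIntegral.integral_finsetSum fun l _ =>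
      Continuous.intervalIntegrable (by fun_prop) _ _]
    exact Finset.sum_congr rfl fun l _ => integral_pow_mul_one_sub_cpow (by linarith) l
  have hrem : Tendsto (fun M : ℕ => ∫ s in (0 : ℝ)..1,
      (s : ℂ) ^ M * ((1 - (s : ℂ) ^ a) / (1 - s))) atTop (𝓝 0) :=
    squeeze_zero_norm (norm_integral_pow_mul_one_sub_cpow_div_le ha)
      ((mul_zero ‖a‖) ▸ tendsto_one_div_add_atTop_nhds_zero_nat.const_mul ‖a‖)
  have hlim := hrem.const_sub (∫ s in (0 : ℝ)..1, (1 - (s : ℂ) ^ a) / (1 - s))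
  rw [sub_zero] at hlim
  exact tendsto_nhds_unique (hlim.congr hpartial)
    (summable_complexHarmonic (by linarith)).hasSum.tendsto_sum_nat

end ComplexHarmonicIntegral

section SegmentSums

theorem descPochhammer_succ_eval_left (i : ℕ) (a : ℂ) :
    (descPochhammer ℂ (i + 1)).eval a = a * (descPochhammer ℂ i).eval (a - 1) := by
  simp [descPochhammer_succ_left]

theorem descPochhammer_eval_mul_integral {a : ℂ} {i : ℕ} (ha : (i : ℝ) < a.re) :
    (descPochhammer ℂ (i + 1)).eval a
      * ∫ s in (0 : ℝ)..1, ((1 - s : ℝ) : ℂ) ^ i * (s : ℂ) ^ (a - 1 - i) = i.factorial := by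
  have hbeta : ∫ s in (0 : ℝ)..1, ((1 - s : ℝ) : ℂ) ^ i * (s : ℂ) ^ (a - 1 - i)
      = Complex.betaIntegral (a - i) (i + 1) := by
    refine intervalIntegral.integral_congr fun s _ => ?_
    simp only [add_sub_cancel_right, Complex.cpow_natCast]
    rw [sub_right_comm, mul_comm]
    push_cast
    rfl
  have hre : 0 < (a - i).re := by simpa using ha
  have hdesc : (descPochhammer ℂ (i + 1)).eval a = ∏ j ∈ Finset.range (i + 1), (a - i + j) := by
    rw [descPochhammer_eval_eq_prod_range, ← Finset.prod_range_reflect]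
    refine Finset.prod_congr rfl fun j hj => ?_
    rw [Nat.add_sub_cancel, Nat.cast_sub (Nat.lt_succ_iff.1 (Finset.mem_range.1 hj))]
    ring
  rw [hbeta, Complex.betaIntegral_eval_nat_add_one_right hre, hdesc, mul_div_cancel₀]
  refine Finset.prod_ne_zero_iff.2 fun j _ hj => ?_
  have hj_re : 0 < (a - i + j).re := by
    rw [Complex.add_re, Complex.natCast_re]; positivity
  simp [hj] at hj_re

theorem continuous_one_sub_pow_mul {a : ℂ} {i : ℕ} (ha : (i : ℝ) + 1 < a.re) :
    Continuous fun s : ℝ => ((1 - s : ℝ) : ℂ) ^ i * (1 - (s : ℂ) ^ (a - 1 - i)) := by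
  have := Complex.continuous_ofReal_cpow_const (y := a - 1 - i) (by simpa using by linarith)
  fun_prop

theorem descPochhammer_eval_mul_integral_boundary {a : ℂ} {i : ℕ} (ha : (i : ℝ) + 1 < a.re) :
    (descPochhammer ℂ (i + 1)).eval a
        * ∫ s in (0 : ℝ)..1, ((1 - s : ℝ) : ℂ) ^ i * (1 - (s : ℂ) ^ (a - 1 - i))
      = (descPochhammer ℂ (i + 1)).eval a / (i + 1) - i.factorial := by
  have hcont := Complex.continuous_ofReal_cpow_const (y := a - 1 - i) (by simpa using by linarith)
  have hpow : ∫ s in (0 : ℝ)..1, ((1 - s : ℝ) : ℂ) ^ i = ((i : ℂ) + 1)⁻¹ := by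
    simp_rw [← Complex.ofReal_pow]
    rw [intervalIntegral.integral_ofReal,
      intervalIntegral.integral_comp_sub_left (fun s => s ^ i), integral_pow]
    simp
  simp_rw [mul_sub, mul_one]
  rw [intervalIntegral.integral_sub (Continuous.intervalIntegrable (by fun_prop) _ _)
    (Continuous.intervalIntegrable (by fun_prop) _ _), mul_sub, hpow,
    descPochhammer_eval_mul_integral (by linarith), div_eq_mul_inv]

/-- The `i`-th derivative of `y ↦ a * (s + (1 - s) * y / n) ^ (a - 1)`, whose argument runs through
the segment from `s` to `1` as `y` goes from `0` to `n`. -/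
noncomputable def segmentDeriv (a : ℂ) (s : ℝ) (n i : ℕ) (y : ℝ) : ℂ :=
  a * (((1 - s) / n : ℝ) ^ i * cpowDeriv (a - 1) i (s + (1 - s) / n * y))

theorem segmentDeriv_zero (a : ℂ) (s : ℝ) (n : ℕ) (y : ℝ) :
    segmentDeriv a s n 0 y = a * ((s + (1 - s) / n * y : ℝ) : ℂ) ^ (a - 1) := by
  rw [segmentDeriv, cpowDeriv_zero, pow_zero, one_mul]

theorem add_div_mul_mem_Ioc {s y : ℝ} {n : ℕ} (hs : s ∈ Set.Ioo (0 : ℝ) 1)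
    (hy : y ∈ Set.Icc (0 : ℝ) n) : s + (1 - s) / n * y ∈ Set.Ioc (0 : ℝ) 1 := by
  have hfrac : y / n ∈ Set.Icc (0 : ℝ) 1 :=
    ⟨div_nonneg hy.1 n.cast_nonneg, div_le_one_of_le₀ hy.2 n.cast_nonneg⟩
  rw [div_mul_eq_mul_div, mul_div_assoc]
  constructor <;> nlinarith [hs.1, hs.2, hfrac.1, hfrac.2]

theorem hasDerivAt_segmentDeriv (a : ℂ) {s : ℝ} {n : ℕ} (i : ℕ) {y : ℝ}
    (hy : 0 < s + (1 - s) / n * y) :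
    HasDerivAt (segmentDeriv a s n i) (segmentDeriv a s n (i + 1) y) y := by
  have haffine : HasDerivAt (fun y => s + (1 - s) / n * y) ((1 - s) / n) y := by
    simpa using ((hasDerivAt_id y).const_mul ((1 - s) / n)).const_add s
  refine ((((hasDerivAt_cpowDeriv (a - 1) i hy).scomp y haffine).const_mul
    (((1 - s) / n : ℝ) ^ i : ℂ)).const_mul a).congr_deriv ?_
  rw [segmentDeriv, Complex.real_smul, pow_succ, mul_assoc]

theorem segmentDeriv_sub (a : ℂ) (s : ℝ) {n : ℕ} (hn : 1 ≤ n) (i : ℕ) :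
    segmentDeriv a s n i n - segmentDeriv a s n i 0
      = ((n : ℂ) ^ i)⁻¹ * ((descPochhammer ℂ (i + 1)).eval a *
          (((1 - s : ℝ) : ℂ) ^ i * (1 - (s : ℂ) ^ (a - 1 - i)))) := by
  have hn_ne : (n : ℝ) ≠ 0 := by exact_mod_cast (by omega : n ≠ 0)
  simp only [segmentDeriv, cpowDeriv, div_mul_cancel₀ _ hn_ne, add_sub_cancel, mul_zero, add_zero,
    Complex.ofReal_one, Complex.one_cpow, descPochhammer_succ_eval_left, Complex.ofReal_div,
    div_pow, Complex.ofReal_natCast]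
  ring

theorem norm_segmentDeriv_le {a : ℂ} {s y : ℝ} {n i : ℕ} (ha : i + 1 ≤ a.re)
    (hs : s ∈ Set.Ioo (0 : ℝ) 1) (hy : y ∈ Set.Icc (0 : ℝ) n) :
    ‖segmentDeriv a s n i y‖ ≤ ‖(descPochhammer ℂ (i + 1)).eval a‖ * ((n : ℝ) ^ i)⁻¹ := by
  have hs₁ : 0 ≤ 1 - s := by linarith [hs.2]
  have hcpow := norm_ofReal_cpow_le_one (z := a - 1 - i) (by simp; linarith)
    (Set.Ioc_subset_Icc_self (add_div_mul_mem_Ioc hs hy))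
  have hpow : ((1 - s) / n) ^ i ≤ ((n : ℝ) ^ i)⁻¹ := by
    rw [← inv_pow, ← one_div]
    gcongr
    linarith [hs.1]
  calc ‖segmentDeriv a s n i y‖
      = ‖(descPochhammer ℂ (i + 1)).eval a‖ *
          (((1 - s) / n) ^ i * ‖((s + (1 - s) / n * y : ℝ) : ℂ) ^ (a - 1 - i)‖) := by
        rw [segmentDeriv, cpowDeriv, descPochhammer_succ_eval_left, norm_mul, norm_mul, norm_mul,
          norm_mul, norm_pow, Complex.norm_real, Real.norm_of_nonneg (by positivity)]
        ring
    _ ≤ ‖(descPochhammer ℂ (i + 1)).eval a‖ * (((n : ℝ) ^ i)⁻¹ * 1) := by gcongr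
    _ = _ := by rw [mul_one]

theorem exists_bound_segment_sum (N : ℕ) : ∃ K : ℝ, 0 ≤ K ∧ ∀ (a : ℂ) (s : ℝ) (n : ℕ),
    1 ≤ n → N + 2 ≤ a.re → s ∈ Set.Ioo (0 : ℝ) 1 →
    ‖∑ k ∈ Finset.range n, a * ((s + (1 - s) / n * k : ℝ) : ℂ) ^ (a - 1)
      - (n * ((1 - (s : ℂ) ^ a) / (1 - s)) + ∑ i ∈ Finset.range (N + 1), emCoeff i *
          (((n : ℂ) ^ i)⁻¹ * ((descPochhammer ℂ (i + 1)).eval a *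
            (((1 - s : ℝ) : ℂ) ^ i * (1 - (s : ℂ) ^ (a - 1 - i))))))‖ ≤
      K * (‖(descPochhammer ℂ (N + 2)).eval a‖ * ((n : ℝ) ^ N)⁻¹) := by
  obtain ⟨K, hK, hem⟩ := exists_bound_eulerMaclaurin ℂ N
  refine ⟨K, hK, fun a s n hn ha hs => ?_⟩
  have hn_ne : (n : ℝ) ≠ 0 := by exact_mod_cast (by omega : n ≠ 0)
  have hderiv : ∀ i, ∀ y ∈ Set.Icc (0 : ℝ) n,
      HasDerivAt (segmentDeriv a s n i) (segmentDeriv a s n (i + 1) y) y :=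
    fun i y hy => hasDerivAt_segmentDeriv a i (add_div_mul_mem_Ioc hs hy).1
  have hsum := hem (segmentDeriv a s n) 0 n
    (‖(descPochhammer ℂ (N + 2)).eval a‖ * ((n : ℝ) ^ (N + 1))⁻¹)
    (by simpa using fun i _ => hderiv i)
    (by simpa using HasDerivAt.continuousOn (hderiv (N + 1)))
    fun y hy => norm_segmentDeriv_le (by push_cast; linarith) hs (by simpa using hy)
  simp only [zero_add, emBoundary, ← Finset.sum_sub_distrib, ← smul_sub, segmentDeriv_sub a s hn]
    at hsum
  simp only [segmentDeriv_zero, Complex.real_smul, Complex.ofReal_natCast,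
    integral_affine_cpow (by linarith [N.cast_nonneg (α := ℝ)] : 0 < a.re) hs.2.ne hn_ne] at hsum
  refine hsum.trans_eq ?_
  have hpow : (n : ℝ) * ((n : ℝ) ^ (N + 1))⁻¹ = ((n : ℝ) ^ N)⁻¹ := by
    rw [pow_succ]
    field_simp
  rw [mul_left_comm (n : ℝ), hpow]

theorem continuous_affine_cpow {a : ℂ} (ha : 1 < a.re) (s t : ℝ) :
    Continuous fun y : ℝ => a * ((s + t * y : ℝ) : ℂ) ^ (a - 1) :=
  continuous_const.mul ((Complex.continuous_ofReal_cpow_const (y := a - 1)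
    (by simpa using ha)).comp (by fun_prop))

theorem integral_sum_segment {a : ℂ} (ha : 1 < a.re) (n : ℕ) :
    IntervalIntegrable (fun s : ℝ => ∑ k ∈ Finset.range n,
      a * ((s + (1 - s) / n * k : ℝ) : ℂ) ^ (a - 1)) MeasureTheory.volume 0 1 ∧
    ∫ s in (0 : ℝ)..1, ∑ k ∈ Finset.range n, a * ((s + (1 - s) / n * k : ℝ) : ℂ) ^ (a - 1)
      = ∑ k ∈ Finset.range n, (1 - ((k / n : ℝ) : ℂ) ^ a) / (1 - (k / n : ℝ)) := by
  have hswap (k : ℕ) (s : ℝ) : s + (1 - s) / n * k = k / n + (1 - k / n) / 1 * s := by ring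
  have hcont (k : ℕ) := continuous_affine_cpow ha (k / n) ((1 - k / n) / 1)
  simp only [hswap]
  refine ⟨(continuous_finsetSum _ fun k _ => hcont k).intervalIntegrable _ _, ?_⟩
  rw [intervalIntegral.integral_finsetSum fun k _ => (hcont k).intervalIntegrable _ _]
  refine Finset.sum_congr rfl fun k hk => ?_
  have hk : (k : ℝ) < n := by exact_mod_cast Finset.mem_range.1 hk
  have hfrac : (k / n : ℝ) ≠ 1 := ((div_lt_one (by linarith [k.cast_nonneg (α := ℝ)])).2 hk).ne
  simpa using integral_affine_cpow (by linarith) hfrac one_ne_zero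

theorem integral_segment_boundary {a : ℂ} {N : ℕ} (ha : N + 1 < a.re) (n : ℕ) :
    IntervalIntegrable (fun s : ℝ => ∑ i ∈ Finset.range (N + 1), emCoeff i *
      (((n : ℂ) ^ i)⁻¹ * ((descPochhammer ℂ (i + 1)).eval a *
        (((1 - s : ℝ) : ℂ) ^ i * (1 - (s : ℂ) ^ (a - 1 - i)))))) MeasureTheory.volume 0 1 ∧
    ∫ s in (0 : ℝ)..1, ∑ i ∈ Finset.range (N + 1), (emCoeff i : ℂ) *
      (((n : ℂ) ^ i)⁻¹ * ((descPochhammer ℂ (i + 1)).eval a *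
        (((1 - s : ℝ) : ℂ) ^ i * (1 - (s : ℂ) ^ (a - 1 - i)))))
      = ∑ i ∈ Finset.range (N + 1), emCoeff i *
          (((n : ℂ) ^ i)⁻¹ * ((descPochhammer ℂ (i + 1)).eval a / (i + 1) - i.factorial)) := by
  have hre (i) (hi : i ∈ Finset.range (N + 1)) : (i : ℝ) + 1 < a.re := by
    have : (i : ℝ) ≤ N := by exact_mod_cast Nat.lt_succ_iff.1 (Finset.mem_range.1 hi)
    linarith
  have hcont (i) (hi : i ∈ Finset.range (N + 1)) : Continuous fun s : ℝ => (emCoeff i : ℂ) *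
      (((n : ℂ) ^ i)⁻¹ * ((descPochhammer ℂ (i + 1)).eval a *
        (((1 - s : ℝ) : ℂ) ^ i * (1 - (s : ℂ) ^ (a - 1 - i))))) := by
    have := continuous_one_sub_pow_mul (hre i hi)
    fun_prop
  refine ⟨(continuous_finsetSum _ hcont).intervalIntegrable _ _, ?_⟩
  rw [intervalIntegral.integral_finsetSum fun i hi => (hcont i hi).intervalIntegrable _ _]
  refine Finset.sum_congr rfl fun i hi => ?_
  simp only [intervalIntegral.integral_const_mul,
    descPochhammer_eval_mul_integral_boundary (hre i hi)]

theorem exists_bound_sum_one_sub_cpow_div (N : ℕ) : ∃ K : ℝ, 0 ≤ K ∧ ∀ (a : ℂ) (n : ℕ),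
    1 ≤ n → N + 2 ≤ a.re →
    ‖∑ k ∈ Finset.range n, (1 - ((k / n : ℝ) : ℂ) ^ a) / (1 - (k / n : ℝ))
      - (n * complexHarmonic a + ∑ i ∈ Finset.range (N + 1), emCoeff i *
          (((n : ℂ) ^ i)⁻¹ * ((descPochhammer ℂ (i + 1)).eval a / (i + 1) - i.factorial)))‖ ≤
      K * (‖(descPochhammer ℂ (N + 2)).eval a‖ * ((n : ℝ) ^ N)⁻¹) := by
  obtain ⟨K, hK, hsegment⟩ := exists_bound_segment_sum N
  refine ⟨K, hK, fun a n hn ha => ?_⟩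
  have ha₁ : N + 1 < a.re := by linarith
  have ha₀ : 1 < a.re := by linarith [N.cast_nonneg (α := ℝ)]
  obtain ⟨hsum_int, hsum⟩ := integral_sum_segment ha₀ n
  obtain ⟨hboundary_int, hboundary⟩ := integral_segment_boundary ha₁ n
  have hharmonic_int := (intervalIntegrable_one_sub_cpow_div ha₀.le).const_mul (n : ℂ)
  rw [← hsum, ← hboundary, ← integral_one_sub_cpow_div ha₀.le,
    ← intervalIntegral.integral_const_mul,
    ← intervalIntegral.integral_add hharmonic_int hboundary_int,
    ← intervalIntegral.integral_sub hsum_int (hharmonic_int.add hboundary_int)]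
  refine (intervalIntegral.norm_integral_le_of_norm_le_const_ae
    (C := K * (‖(descPochhammer ℂ (N + 2)).eval a‖ * ((n : ℝ) ^ N)⁻¹)) ?_).trans (by simp)
  have hne_one : ∀ᵐ s : ℝ, s ≠ 1 := by simp [MeasureTheory.ae_iff]
  filter_upwards [hne_one] with s hs_ne hs
  rw [Set.uIoc_of_le zero_le_one] at hs
  exact hsegment a s n hn ha ⟨hs.1, hs.2.lt_of_ne hs_ne⟩

end SegmentSums

section PowConv

/-- The convolution `∑_{k=1}^{n-1} k^z / (n - k)`, whose `p`-th `z`-derivative at `0` is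
`logSum p n`. -/
noncomputable def powConv (z : ℂ) (n : ℕ) : ℂ :=
  ∑ k ∈ Finset.Ico 1 n, (k : ℂ) ^ z / ((n : ℂ) - k)

/-- The asymptotic factor of `n ^ z` in `powConv z n`, with `N` Bernoulli terms. -/
noncomputable def powConvFactor (N n : ℕ) (z : ℂ) : ℂ :=
  Real.log n + Real.eulerMascheroniConstant - complexHarmonic z
    - ∑ i ∈ Finset.range N,
        emCoeff i * ((descPochhammer ℂ (i + 1)).eval z / (i + 1)) * ((n : ℂ) ^ (i + 1))⁻¹

theorem sum_one_div_natCast_sub (n : ℕ) :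
    ∑ k ∈ Finset.Ico 1 n, 1 / ((n : ℂ) - k) = powSum (-1) n := by
  have hreflect := Finset.sum_Ico_reflect (fun k : ℕ => (k : ℂ) ^ (-1 : ℂ)) 1 n.le_succ
  rw [Nat.add_sub_cancel_left, Nat.add_sub_cancel] at hreflect
  rw [powSum, ← hreflect]
  refine Finset.sum_congr rfl fun k hk => ?_
  rw [Complex.cpow_neg_one, Nat.cast_sub (Finset.mem_Ico.1 hk).2.le, one_div]

theorem powConv_eq_cpow_mul {a : ℂ} (ha : a ≠ 0) {n : ℕ} (hn : 1 ≤ n) :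
    powConv a n = (n : ℂ) ^ a * (powSum (-1) n + (n : ℂ)⁻¹ - (n : ℂ)⁻¹ *
      ∑ k ∈ Finset.range n, (1 - ((k / n : ℝ) : ℂ) ^ a) / (1 - (k / n : ℝ))) := by
  have hn₀ : (0 : ℝ) < n := by exact_mod_cast hn
  have hterm (k) (hk : k ∈ Finset.Ico 1 n) : (k : ℂ) ^ a / ((n : ℂ) - k) = (n : ℂ) ^ a *
      (1 / ((n : ℂ) - k) - (n : ℂ)⁻¹ * ((1 - ((k / n : ℝ) : ℂ) ^ a) / (1 - (k / n : ℝ)))) := by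
    have hk_lt : (k : ℝ) < n := by exact_mod_cast (Finset.mem_Ico.1 hk).2
    have hn_ne : (n : ℂ) ≠ 0 := by exact_mod_cast hn₀.ne'
    have hsub_ne : (n : ℂ) - k ≠ 0 := by exact_mod_cast (sub_pos.2 hk_lt).ne'
    have hfrac : (1 : ℂ) - ((k / n : ℝ) : ℂ) = (n - k) / n := by push_cast; field_simp
    have hcpow : (k : ℂ) ^ a = (n : ℂ) ^ a * ((k / n : ℝ) : ℂ) ^ a := by
      have := Complex.mul_cpow_ofReal_nonneg hn₀.le (div_nonneg k.cast_nonneg hn₀.le) a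
      rw [← Complex.ofReal_natCast n, ← this, ← Complex.ofReal_mul, mul_div_cancel₀ _ hn₀.ne',
        Complex.ofReal_natCast]
    rw [hcpow, hfrac]
    field_simp
    ring
  rw [powConv, Finset.sum_congr rfl hterm, ← Finset.mul_sum, Finset.sum_sub_distrib,
    sum_one_div_natCast_sub, ← Finset.mul_sum, Finset.range_eq_Ico,
    Finset.sum_eq_sum_Ico_succ_bot hn]
  simp only [Nat.cast_zero, zero_div, Complex.ofReal_zero, Complex.zero_cpow ha, sub_zero, div_one,
    zero_add]
  ring

theorem isBigO_powSum_neg_one_sub (N : ℕ) :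
    (fun n : ℕ => powSum (-1) n - (Real.log n + Real.eulerMascheroniConstant)
      - emBoundary N (cpowDeriv (-1)) n) =O[atTop] fun n : ℕ => (n : ℝ) ^ (-1 - N : ℝ) := by
  have hslice : Tendsto (fun n : ℕ => (n, (-1 : ℂ))) atTop
      (atTop ×ˢ 𝓟 (Metric.closedBall (0 : ℂ) 1)) :=
    tendsto_id.prodMk (tendsto_principal.2 (by simp))
  refine ((isBigO_zetaApprox_sub N 1).comp_tendsto hslice).congr' ?_ (by simp [Function.comp_def])
  filter_upwards [eventually_ge_atTop 1] with n hn
  simp only [Function.comp_apply, zetaApprox, integral_one_ofReal_cpow_neg_one hn, neg_neg,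
    riemannZeta₀_one]
  ring

theorem descPochhammer_eval_neg_one (i : ℕ) :
    (descPochhammer ℂ i).eval (-1) = (-1) ^ i * i.factorial := by
  induction i with
  | zero => simp
  | succ i ih => rw [descPochhammer_succ_eval, ih, Nat.factorial_succ]; push_cast; ring

theorem neg_one_pow_mul_emCoeff_succ (i : ℕ) :
    (-1) ^ (i + 1) * emCoeff (i + 1) = -emCoeff (i + 1) := by
  rw [emCoeff]
  rcases Nat.even_or_odd i with hi | hi
  · rw [hi.add_one.neg_one_pow, neg_one_mul]
  · rw [bernoulli_eq_zero_of_odd (by simpa [Nat.odd_add_one, parity_simps] using hi) (by omega)]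
    simp

theorem emBoundary_cpowDeriv_neg_one_add (N n : ℕ) :
    emBoundary (N + 1) (cpowDeriv (-1)) n + (n : ℂ)⁻¹
      + ∑ i ∈ Finset.range (N + 1), emCoeff i * (i.factorial * ((n : ℂ) ^ (i + 1))⁻¹) = 0 := by
  have hderiv (i : ℕ) :
      cpowDeriv (-1) i n = (-1) ^ i * (i.factorial * ((n : ℂ) ^ (i + 1))⁻¹) := by
    rw [cpowDeriv, descPochhammer_eval_neg_one, Complex.ofReal_natCast, mul_assoc,
      show (-1 - i : ℂ) = -((i + 1 : ℕ) : ℂ) by push_cast; ring, Complex.cpow_neg,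
      Complex.cpow_natCast]
  induction N with
  | zero =>
    simp only [emBoundary, zero_add, Finset.sum_range_one, hderiv, emCoeff, bernoulli_one,
      Nat.factorial, Complex.real_smul]
    push_cast
    ring
  | succ N ih =>
    have hparity : (-1 : ℂ) ^ (N + 1) * emCoeff (N + 1) = -emCoeff (N + 1) := by
      exact_mod_cast neg_one_pow_mul_emCoeff_succ N
    rw [emBoundary_succ, Finset.sum_range_succ, hderiv, Complex.real_smul]
    linear_combination ih
      + (N + 1).factorial * ((n : ℂ) ^ (N + 1 + 1))⁻¹ * hparity

theorem isBigO_sum_one_sub_cpow_div (N : ℕ) (R : ℝ) :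
    (fun x : ℕ × ℂ =>
      ∑ k ∈ Finset.range x.1, (1 - ((k / x.1 : ℝ) : ℂ) ^ x.2) / (1 - (k / x.1 : ℝ))
        - (x.1 * complexHarmonic x.2 + ∑ i ∈ Finset.range (N + 1), emCoeff i *
          (((x.1 : ℂ) ^ i)⁻¹ * ((descPochhammer ℂ (i + 1)).eval x.2 / (i + 1) - i.factorial))))
      =O[atTop ×ˢ 𝓟 {a | ‖a‖ ≤ R ∧ (N : ℝ) + 2 ≤ a.re}] fun x => ((x.1 : ℝ) ^ N)⁻¹ := by
  obtain ⟨K, hK, hsum⟩ := exists_bound_sum_one_sub_cpow_div N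
  obtain ⟨D, -, hdesc⟩ := exists_bound_eval_descPochhammer (N + 2) R
  refine .of_bound (K * D) (eventually_prod_principal_iff.2 ?_)
  filter_upwards [eventually_ge_atTop 1] with n hn a ⟨ha, hre⟩
  rw [Real.norm_of_nonneg (by positivity), mul_assoc]
  exact (hsum a n hn hre).trans (by gcongr; exact hdesc a ha)

theorem powConv_sub_eq_cpow_mul (N : ℕ) {a : ℂ} (ha : a ≠ 0) {n : ℕ} (hn : 1 ≤ n) :
    powConv a n - (n : ℂ) ^ a * powConvFactor (N + 1) n a = (n : ℂ) ^ a *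
      (powSum (-1) n - (Real.log n + Real.eulerMascheroniConstant)
        - emBoundary (N + 1) (cpowDeriv (-1)) n - (n : ℂ)⁻¹ *
          (∑ k ∈ Finset.range n, (1 - ((k / n : ℝ) : ℂ) ^ a) / (1 - (k / n : ℝ))
            - (n * complexHarmonic a + ∑ i ∈ Finset.range (N + 1), emCoeff i *
              (((n : ℂ) ^ i)⁻¹ *
                ((descPochhammer ℂ (i + 1)).eval a / (i + 1) - i.factorial))))) := by
  have hn_ne : (n : ℂ) ≠ 0 := by exact_mod_cast (by omega : n ≠ 0)
  have hsum : (n : ℂ)⁻¹ * ∑ i ∈ Finset.range (N + 1), emCoeff i *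
        (((n : ℂ) ^ i)⁻¹ * ((descPochhammer ℂ (i + 1)).eval a / (i + 1) - i.factorial))
      = ∑ i ∈ Finset.range (N + 1),
          emCoeff i * ((descPochhammer ℂ (i + 1)).eval a / (i + 1)) * ((n : ℂ) ^ (i + 1))⁻¹
        - ∑ i ∈ Finset.range (N + 1), emCoeff i * (i.factorial * ((n : ℂ) ^ (i + 1))⁻¹) := by
    rw [Finset.mul_sum, ← Finset.sum_sub_distrib]
    refine Finset.sum_congr rfl fun i _ => ?_
    rw [pow_succ, mul_inv]
    ring
  have hharmonic : (n : ℂ)⁻¹ * (n * complexHarmonic a) = complexHarmonic a :=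
    inv_mul_cancel_left₀ hn_ne _
  rw [powConv_eq_cpow_mul ha hn, ← mul_sub, powConvFactor]
  congr 1
  linear_combination -hsum - hharmonic + emBoundary_cpowDeriv_neg_one_add N n

theorem isBigO_natCast_cpow (s : Set ℂ) :
    (fun x : ℕ × ℂ => (x.1 : ℂ) ^ x.2) =O[atTop ×ˢ 𝓟 s] fun x => (x.1 : ℝ) ^ x.2.re := by
  refine .of_bound' (eventually_prod_principal_iff.2 ?_)
  filter_upwards [eventually_ge_atTop 1] with n hn a _
  rw [Complex.norm_natCast_cpow_of_pos hn]
  exact le_abs_self _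

theorem isBigO_powConv_sub_of_le_re (N : ℕ) (R : ℝ) :
    (fun x : ℕ × ℂ => powConv x.2 x.1 - (x.1 : ℂ) ^ x.2 * powConvFactor (N + 1) x.1 x.2)
      =O[atTop ×ˢ 𝓟 {a | ‖a‖ ≤ R ∧ (N : ℝ) + 2 ≤ a.re}]
        fun x => (x.1 : ℝ) ^ (x.2.re - (N + 1 : ℕ)) := by
  have hpow : (fun n : ℕ => (n : ℝ) ^ (-1 - (N + 1 : ℕ) : ℝ))
      =O[atTop] fun n => ((n : ℝ) ^ (N + 1))⁻¹ := by
    refine .of_bound' ?_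
    filter_upwards [eventually_ge_atTop 1] with n hn
    rw [Real.norm_of_nonneg (by positivity), Real.norm_of_nonneg (by positivity),
      ← Real.rpow_natCast, ← Real.rpow_neg (by positivity)]
    exact Real.rpow_le_rpow_of_exponent_le (by exact_mod_cast hn) (by linarith)
  have hharmonic := ((isBigO_powSum_neg_one_sub (N + 1)).trans hpow).comp_fst
    (𝓟 {a : ℂ | ‖a‖ ≤ R ∧ (N : ℝ) + 2 ≤ a.re})
  have hinv : (fun x : ℕ × ℂ => (x.1 : ℂ)⁻¹)
      =O[atTop ×ˢ 𝓟 {a | ‖a‖ ≤ R ∧ (N : ℝ) + 2 ≤ a.re}] fun x => (x.1 : ℝ)⁻¹ :=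
    .of_norm_le fun x => by simp
  have hsegment := (hinv.mul (isBigO_sum_one_sub_cpow_div N R)).congr_right
    (g₂ := fun x => ((x.1 : ℝ) ^ (N + 1))⁻¹) fun x => by rw [pow_succ, mul_inv, mul_comm]
  refine ((isBigO_natCast_cpow _).mul (hharmonic.sub hsegment)).congr' ?_ ?_
  · refine eventually_prod_principal_iff.2 ?_
    filter_upwards [eventually_ge_atTop 1] with n hn a ha
    have ha_ne : a ≠ 0 := by
      rintro rfl
      simp only [Complex.zero_re] at ha
      linarith [ha.2, N.cast_nonneg (α := ℝ)]
    exact (powConv_sub_eq_cpow_mul N ha_ne hn).symm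
  · refine eventually_prod_principal_iff.2 ?_
    filter_upwards [eventually_ge_atTop 1] with n hn a _
    exact ((Real.rpow_sub_natCast (by positivity) _ _).trans (div_eq_mul_inv _ _)).symm

theorem powConv_eq_inv_mul_add (z : ℂ) {n : ℕ} (hn : 1 ≤ n) :
    powConv z n = (n : ℂ)⁻¹ * (powSum z n + powConv (z + 1) n) := by
  have hn_ne : (n : ℂ) ≠ 0 := by exact_mod_cast (by omega : n ≠ 0)
  rw [powConv, powConv, powSum, ← Finset.sum_add_distrib, Finset.mul_sum]
  refine Finset.sum_congr rfl fun k hk => ?_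
  obtain ⟨hk₁, hkn⟩ := Finset.mem_Ico.1 hk
  have hk_ne : (k : ℂ) ≠ 0 := by exact_mod_cast (by omega : k ≠ 0)
  have hsub_ne : (n : ℂ) - k ≠ 0 := sub_ne_zero.2 (by exact_mod_cast hkn.ne')
  rw [Complex.cpow_add _ _ hk_ne, Complex.cpow_one]
  field_simp
  ring

theorem descPochhammer_eval_add_one_sub (z : ℂ) (i : ℕ) :
    (descPochhammer ℂ (i + 1)).eval (z + 1) - (descPochhammer ℂ (i + 1)).eval z
      = (i + 1) * (descPochhammer ℂ i).eval z := by
  rw [descPochhammer_succ_eval_left, add_sub_cancel_right, descPochhammer_succ_eval]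
  ring

theorem powConvFactor_sub_add_one (N n : ℕ) {z : ℂ} (hz : -1 / 2 ≤ z.re) :
    powConvFactor N n z - powConvFactor N n (z + 1) = (z + 1)⁻¹
      + ∑ i ∈ Finset.range N,
          emCoeff i * (descPochhammer ℂ i).eval z * ((n : ℂ) ^ (i + 1))⁻¹ := by
  have hsum : ∑ i ∈ Finset.range N, (emCoeff i : ℂ)
        * ((descPochhammer ℂ (i + 1)).eval (z + 1) / (i + 1)) * ((n : ℂ) ^ (i + 1))⁻¹
      - ∑ i ∈ Finset.range N, (emCoeff i : ℂ)
        * ((descPochhammer ℂ (i + 1)).eval z / (i + 1)) * ((n : ℂ) ^ (i + 1))⁻¹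
      = ∑ i ∈ Finset.range N,
          emCoeff i * (descPochhammer ℂ i).eval z * ((n : ℂ) ^ (i + 1))⁻¹ := by
    rw [← Finset.sum_sub_distrib]
    refine Finset.sum_congr rfl fun i _ => ?_
    rw [← sub_mul, ← mul_sub, ← sub_div, descPochhammer_eval_add_one_sub,
      mul_div_cancel_left₀ _ i.cast_add_one_ne_zero]
  rw [powConvFactor, powConvFactor, complexHarmonic_add_one hz, ← hsum]
  ring

theorem cpow_mul_powConvFactor (N : ℕ) {n : ℕ} (hn : 1 ≤ n) {z : ℂ} (hz : -1 / 2 ≤ z.re) :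
    (n : ℂ) ^ z * powConvFactor N n z
      = (n : ℂ)⁻¹ * ((n : ℂ) ^ (z + 1) / (z + 1) + emBoundary N (cpowDeriv z) n
        + (n : ℂ) ^ (z + 1) * powConvFactor N n (z + 1)) := by
  have hn_ne : (n : ℂ) ≠ 0 := by exact_mod_cast (by omega : n ≠ 0)
  have hboundary : emBoundary N (cpowDeriv z) n = (n : ℂ) ^ (z + 1) *
      ∑ i ∈ Finset.range N,
        emCoeff i * (descPochhammer ℂ i).eval z * ((n : ℂ) ^ (i + 1))⁻¹ := by
    rw [emBoundary, Finset.mul_sum]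
    refine Finset.sum_congr rfl fun i _ => ?_
    rw [cpowDeriv, Complex.real_smul, Complex.ofReal_natCast, Complex.cpow_sub _ _ hn_ne,
      Complex.cpow_add _ _ hn_ne, Complex.cpow_one, Complex.cpow_natCast, pow_succ]
    field_simp
  rw [eq_add_of_sub_eq (powConvFactor_sub_add_one N n hz), hboundary,
    Complex.cpow_add _ _ hn_ne, Complex.cpow_one]
  field_simp

/-- The difference between `powConv z n` and its asymptotic expansion with `N` Bernoulli terms and
`M` zeta terms. -/
noncomputable def powConvError (N M n : ℕ) (z : ℂ) : ℂ :=
  powConv z n - (n : ℂ) ^ z * powConvFactor N n z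
    - ∑ j ∈ Finset.range M, riemannZeta (-(z + j)) * ((n : ℂ) ^ (j + 1))⁻¹

theorem powConvError_succ (N M : ℕ) {n : ℕ} (hn : 1 ≤ n) {z : ℂ} (hz : -1 / 2 ≤ z.re) :
    powConvError N (M + 1) n z
      = (n : ℂ)⁻¹ * (zetaApprox N n z - riemannZeta₀ (-z) + powConvError N M n (z + 1)) := by
  have hz_ne : z ≠ -1 := by
    rintro rfl
    norm_num at hz
  have hzeta : ∑ j ∈ Finset.range M, riemannZeta (-(z + (j + 1 : ℕ))) * ((n : ℂ) ^ (j + 1 + 1))⁻¹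
      = (n : ℂ)⁻¹ *
        ∑ j ∈ Finset.range M, riemannZeta (-(z + 1 + j)) * ((n : ℂ) ^ (j + 1))⁻¹ := by
    rw [Finset.mul_sum]
    refine Finset.sum_congr rfl fun j _ => ?_
    rw [pow_succ _ (j + 1), mul_inv, Nat.cast_add_one, add_right_comm z, ← add_assoc]
    ring
  rw [powConvError, powConvError, zetaApprox_sub_riemannZeta₀ hn hz_ne, Finset.sum_range_succ',
    hzeta, powConv_eq_inv_mul_add z hn, cpow_mul_powConvFactor N hn hz]
  simp only [Nat.cast_zero, add_zero, zero_add, pow_one]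
  ring

theorem isBigO_powConvError (N M : ℕ) (R : ℝ) :
    (fun x : ℕ × ℂ => powConvError (N + 1) M x.1 x.2)
      =O[atTop ×ˢ 𝓟 {z | ‖z‖ ≤ R ∧ -1 / 2 ≤ z.re ∧ (N : ℝ) + 2 ≤ z.re + M}]
        fun x => (x.1 : ℝ) ^ (x.2.re - (N + 1 : ℕ)) := by
  induction M generalizing R with
  | zero =>
    simp only [powConvError, Finset.range_zero, Finset.sum_empty, sub_zero]
    refine (isBigO_powConv_sub_of_le_re N R).mono (prod_mono le_rfl (principal_mono.2 ?_))
    rintro z ⟨hz, -, hre⟩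
    exact ⟨hz, by simpa using hre⟩
  | succ M ih =>
    set s : Set ℂ := {z | ‖z‖ ≤ R ∧ -1 / 2 ≤ z.re ∧ (N : ℝ) + 2 ≤ z.re + (M + 1 : ℕ)}
    have hshift : Tendsto (Prod.map id (· + 1)) (atTop ×ˢ 𝓟 s) ((atTop : Filter ℕ) ×ˢ
        𝓟 {z : ℂ | ‖z‖ ≤ R + 1 ∧ -1 / 2 ≤ z.re ∧ (N : ℝ) + 2 ≤ z.re + M}) := by
      refine tendsto_id.prodMap (tendsto_principal_principal.2 ?_)
      rintro z ⟨hz, hre, hM⟩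
      push_cast at hM
      exact ⟨(norm_add_le _ _).trans (by simpa using hz),
        by rw [Complex.add_re, Complex.one_re]; linarith,
        by rw [Complex.add_re, Complex.one_re]; linarith⟩
    have hzeta : (fun x : ℕ × ℂ => zetaApprox (N + 1) x.1 x.2 - riemannZeta₀ (-x.2))
        =O[atTop ×ˢ 𝓟 s] fun x => (x.1 : ℝ) ^ (x.2.re + 1 - (N + 1 : ℕ)) := by
      have hweaken := isBigO_rpow_re_sub (s := s) (sub_le_self ((N + 1 : ℕ) : ℝ) zero_le_one)
      simp only [sub_sub_eq_add_sub] at hweaken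
      exact ((isBigO_zetaApprox_sub (N + 1) R).mono (prod_mono le_rfl
        (principal_mono.2 fun z hz => mem_closedBall_zero_iff.2 hz.1))).trans hweaken
    have hinv : (fun x : ℕ × ℂ => (x.1 : ℂ)⁻¹) =O[atTop ×ˢ 𝓟 s] fun x => (x.1 : ℝ)⁻¹ :=
      .of_norm_le fun x => by simp
    refine (hinv.mul (hzeta.add ((ih (R + 1)).comp_tendsto hshift))).congr' ?_ ?_ <;>
      refine eventually_prod_principal_iff.2 ?_ <;>
      filter_upwards [eventually_ge_atTop 1] with n hn z hz
    · exact (powConvError_succ _ _ hn hz.2.1).symm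
    · have hn₀ : (0 : ℝ) < n := by exact_mod_cast hn
      rw [add_sub_right_comm, Real.rpow_add_one hn₀.ne']
      field_simp

end PowConv

section DerivativesAtZero

theorem isBigO_iteratedDeriv {ι E F : Type*} [NormedAddCommGroup E] [NormedSpace ℂ E]
    [CompleteSpace E] [Norm F] {l : Filter ι} {f : ι → ℂ → E} {g : ι → F} {c : ℂ} {R : ℝ}
    (hR : 0 < R) (hf : ∀ᶠ i in l, DifferentiableOn ℂ (f i) (Metric.ball c R))
    (hfg : (fun x : ι × ℂ => f x.1 x.2) =O[l ×ˢ 𝓟 (Metric.ball c R)] fun x => g x.1) (p : ℕ) :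
    (fun i => iteratedDeriv p (f i) c) =O[l] g := by
  obtain ⟨K, hK⟩ := hfg.bound
  refine IsBigO.of_bound (p.factorial * K / (R / 2) ^ p) ?_
  filter_upwards [hf, eventually_prod_principal_iff.1 hK] with i hdiff hbound
  refine (Complex.norm_iteratedDeriv_le_of_forall_mem_sphere_norm_le p (half_pos hR)
    (hdiff.diffContOnCl_ball (Metric.closedBall_subset_ball (half_lt_self hR)))
    fun z hz => hbound z ?_).trans_eq (by ring)
  exact Metric.closedBall_subset_ball (half_lt_self hR) (Metric.sphere_subset_closedBall hz)

theorem iteratedDeriv_natCast_cpow_zero (p : ℕ) {n : ℕ} (hn : 1 ≤ n) :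
    iteratedDeriv p (fun z : ℂ => (n : ℂ) ^ z) 0 = (Real.log n : ℂ) ^ p := by
  have hn_ne : (n : ℂ) ≠ 0 := by exact_mod_cast (by omega : n ≠ 0)
  simp only [Complex.cpow_def_of_ne_zero hn_ne, iteratedDeriv_cexp_const_mul, mul_zero,
    Complex.exp_zero, mul_one, Complex.natCast_log]

theorem contDiff_natCast_cpow {n : ℕ} (hn : 1 ≤ n) (k : WithTop ℕ∞) :
    ContDiff ℂ k fun z : ℂ => (n : ℂ) ^ z :=
  (differentiable_natCast_cpow hn).contDiff

theorem iteratedDeriv_natCast_cpow_mul_zero {F : ℂ → ℂ} {p : ℕ} (hF : ContDiffAt ℂ p F 0) {n : ℕ}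
    (hn : 1 ≤ n) :
    iteratedDeriv p (fun z => (n : ℂ) ^ z * F z) 0 = F 0 * (Real.log n : ℂ) ^ p
      + ∑ r ∈ Finset.Icc 1 p,
          (p.choose r : ℂ) * iteratedDeriv r F 0 * (Real.log n : ℂ) ^ (p - r) := by
  simp_rw [mul_comm _ (F _)]
  rw [iteratedDeriv_fun_mul hF (contDiff_natCast_cpow hn p).contDiffAt, Finset.range_eq_Ico,
    Finset.sum_eq_sum_Ico_succ_bot p.succ_pos]
  simp only [iteratedDeriv_natCast_cpow_zero _ hn, Nat.choose_zero_right, Nat.cast_one, one_mul,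
    iteratedDeriv_zero, Nat.sub_zero]
  rfl

theorem choose_mul_factorial_eq_div {K : Type*} [Field K] [CharZero K] {p r : ℕ} (hr : r ≤ p) :
    (p.choose r : K) * r.factorial = p.factorial / (p - r).factorial := by
  rw [eq_div_iff (by exact_mod_cast (p - r).factorial_ne_zero)]
  exact_mod_cast Nat.choose_mul_factorial_mul_factorial hr

theorem iteratedDeriv_polynomial_eval_zero {𝕜 : Type*} [NontriviallyNormedField 𝕜]
    (P : Polynomial 𝕜) (r : ℕ) :
    iteratedDeriv r (fun x => P.eval x) 0 = r.factorial * P.coeff r := by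
  have hiter : iteratedDeriv r (fun x => P.eval x)
      = fun x => (Polynomial.derivative^[r] P).eval x := by
    induction r with
    | zero => rfl
    | succ r ih =>
      ext x
      rw [iteratedDeriv_succ, ih, Polynomial.deriv, Function.iterate_succ_apply']
  rw [congrFun hiter 0, ← Polynomial.coeff_zero_eq_eval_zero,
    Polynomial.coeff_iterate_derivative, zero_add, Nat.descFactorial_self, nsmul_eq_mul]

theorem S_succ_succ (q : ℕ) {s t : ℕ} (hs : s ≤ t + 1) :
    S (q + 1) s (t + 1) = S (q + 1) s t + S q s t / (t + 1) := by
  have hmem : t + 1 ∉ Finset.Icc s t := by simp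
  have hnot {A : Finset ℕ} {k : ℕ} (hA : A ∈ (Finset.Icc s t).powersetCard k) : t + 1 ∉ A :=
    fun h => hmem ((Finset.mem_powersetCard.1 hA).1 h)
  rw [S, ← Finset.insert_Icc_right_eq_Icc_add_one hs, Finset.powersetCard_succ_insert hmem,
    Finset.sum_union, Finset.sum_image]
  · rw [S, S, Finset.sum_div]
    congr 1
    refine Finset.sum_congr rfl fun A hA => ?_
    rw [Finset.prod_insert (hnot hA), Nat.cast_add_one, one_div_mul_eq_div]
  · intro A hA B hB h
    rw [← Finset.erase_insert (hnot hA), h, Finset.erase_insert (hnot hB)]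
  · refine Finset.disjoint_left.2 fun A hA hA' => hnot hA ?_
    obtain ⟨B, -, rfl⟩ := Finset.mem_image.1 hA'
    exact Finset.mem_insert_self _ _

theorem descPochhammer_succ_coeff_succ {K : Type*} [Field K] [CharZero K] (t q : ℕ) :
    (descPochhammer K (t + 1)).coeff (q + 1) = (-1) ^ (t + q) * t.factorial * (S q 1 t : K) := by
  induction t generalizing q with
  | zero =>
    cases q with
    | zero => simp [S]
    | succ q =>
      rw [S, Finset.powersetCard_eq_empty.2 (by simp)]
      simp [Polynomial.coeff_X]
  | succ t ih =>
    have ht : (t : K) + 1 ≠ 0 := t.cast_add_one_ne_zero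
    rw [descPochhammer_succ_right, ← map_natCast Polynomial.C, Polynomial.coeff_mul_X_sub_C, ih]
    cases q with
    | zero =>
      rw [Polynomial.coeff_zero_eq_eval_zero, descPochhammer_ne_zero_eval_zero K t.succ_ne_zero,
        Nat.factorial_succ]
      simp only [S, Finset.powersetCard_zero, Finset.sum_singleton, Finset.prod_empty,
        Rat.cast_one]
      push_cast
      ring
    | succ q =>
      rw [ih, S_succ_succ q (by omega), Nat.factorial_succ]
      push_cast
      field_simp
      ring

theorem differentiable_powConvFactor_term (i n : ℕ) : Differentiable ℂ fun z : ℂ =>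
    emCoeff i * ((descPochhammer ℂ (i + 1)).eval z / (i + 1)) * ((n : ℂ) ^ (i + 1))⁻¹ :=
  (((Polynomial.differentiable _).div_const _).const_mul _).mul_const _

theorem differentiableOn_powConvFactor (N n : ℕ) :
    DifferentiableOn ℂ (powConvFactor N n) (Metric.ball 0 (1 / 2)) :=
  (differentiableOn_complexHarmonic.const_sub _).sub (DifferentiableOn.fun_sum fun i _ =>
    (differentiable_powConvFactor_term i n).differentiableOn)

theorem powConvFactor_zero (N n : ℕ) :
    powConvFactor N n 0 = Real.log n + Real.eulerMascheroniConstant := by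
  simp [powConvFactor, complexHarmonic_zero]

theorem iteratedDeriv_powConvFactor_zero (N n : ℕ) {r : ℕ} (hr : 0 < r) :
    iteratedDeriv r (powConvFactor N n) 0 = (-1) ^ r * r.factorial * riemannZeta (r + 1)
      - ∑ i ∈ Finset.range N, emCoeff i *
          (r.factorial * (descPochhammer ℂ (i + 1)).coeff r / (i + 1)) * ((n : ℂ) ^ (i + 1))⁻¹ := by
  have hharm := contDiffAt_of_differentiableOn_ball one_half_pos differentiableOn_complexHarmonic r
  have hterm (i : ℕ) :=
    (differentiable_powConvFactor_term i n).contDiff.contDiffAt (n := r) (x := 0)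
  unfold powConvFactor
  rw [iteratedDeriv_fun_sub (contDiffAt_const.sub hharm)
      (ContDiffAt.sum fun i _ => hterm i),
    iteratedDeriv_fun_sum fun i _ => hterm i, iteratedDeriv_const_sub hr,
    iteratedDeriv_neg, iteratedDeriv_complexHarmonic_zero hr, neg_neg]
  simp only [iteratedDeriv_mul_const_field, iteratedDeriv_const_mul_field, iteratedDeriv_div_const,
    iteratedDeriv_polynomial_eval_zero]

/-- The part of `coeff p k n` which depends on `n`, coming from the Bernoulli terms of
`powConvFactor`. -/
noncomputable def logCoeff (p k n : ℕ) : ℂ :=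
  -((-1) ^ k * (bernoulli k : ℂ) / (k : ℂ) ^ 2 *
      ∑ r ∈ Finset.Icc 1 p, (d p r k : ℂ) * (Real.log n : ℂ) ^ (p - r))

theorem coeff_succ (p j n : ℕ) :
    coeff p (j + 1) n = logCoeff p (j + 1) n + (-1) ^ p * iteratedDeriv p riemannZeta (-j) := by
  rw [coeff, logCoeff, Nat.cast_add_one, sub_add_cancel_right]
  ring

theorem choose_mul_emCoeff_mul_descPochhammer_coeff (i : ℕ) {p r : ℕ} (hr : r ∈ Finset.Icc 1 p) :
    (p.choose r : ℂ) *
        (emCoeff i * (r.factorial * (descPochhammer ℂ (i + 1)).coeff r / (i + 1)))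
      = (-1) ^ (i + 1) * bernoulli (i + 1) / ((i + 1 : ℕ) : ℂ) ^ 2 * d p r (i + 1) := by
  obtain ⟨hr_pos, hrp⟩ := Finset.mem_Icc.1 hr
  obtain ⟨q, rfl⟩ := Nat.exists_eq_add_of_le' hr_pos
  calc (p.choose (q + 1) : ℂ) *
        (emCoeff i * ((q + 1).factorial * (descPochhammer ℂ (i + 1)).coeff (q + 1) / (i + 1)))
      = p.choose (q + 1) * (q + 1).factorial *
          (emCoeff i * ((descPochhammer ℂ (i + 1)).coeff (q + 1) / (i + 1))) := by ring
    _ = p.factorial / (p - (q + 1)).factorial * (bernoulli (i + 1) / (i + 1).factorial *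
          ((-1) ^ (i + q) * i.factorial * S q 1 i / (i + 1))) := by
      rw [choose_mul_factorial_eq_div hrp, descPochhammer_succ_coeff_succ, emCoeff]
      push_cast
      rfl
    _ = _ := by
      rw [d, Nat.add_sub_cancel, Nat.add_sub_cancel, Nat.factorial_succ]
      have := i.cast_add_one_ne_zero (R := ℂ)
      have := i.factorial_ne_zero
      push_cast
      field_simp
      ring

theorem choose_mul_iteratedDeriv_powConvFactor_zero (N n : ℕ) {p r : ℕ}
    (hr : r ∈ Finset.Icc 1 p) :
    (p.choose r : ℂ) * iteratedDeriv r (powConvFactor N n) 0 = c p r - ∑ i ∈ Finset.range N,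
      (-1) ^ (i + 1) * bernoulli (i + 1) / ((i + 1 : ℕ) : ℂ) ^ 2 * d p r (i + 1)
        * ((n : ℂ) ^ (i + 1))⁻¹ := by
  obtain ⟨hr_pos, hrp⟩ := Finset.mem_Icc.1 hr
  rw [iteratedDeriv_powConvFactor_zero N n hr_pos, mul_sub, Finset.mul_sum]
  congr 1
  · rw [c, mul_div_assoc, ← choose_mul_factorial_eq_div hrp]
    ring
  · refine Finset.sum_congr rfl fun i _ => ?_
    rw [← mul_assoc, choose_mul_emCoeff_mul_descPochhammer_coeff i hr]

theorem iteratedDeriv_cpow_mul_powConvFactor_zero (p N : ℕ) {n : ℕ} (hn : 1 ≤ n) :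
    iteratedDeriv p (fun z => (n : ℂ) ^ z * powConvFactor N n z) 0
      = (Real.log n : ℂ) ^ (p + 1) + Real.eulerMascheroniConstant * (Real.log n : ℂ) ^ p
        + ∑ r ∈ Finset.Icc 1 p, c p r * (Real.log n : ℂ) ^ (p - r)
        + ∑ i ∈ Finset.range N, logCoeff p (i + 1) n * ((n : ℂ) ^ (i + 1))⁻¹ := by
  have hlogCoeff : ∑ r ∈ Finset.Icc 1 p, (∑ i ∈ Finset.range N,
        (-1) ^ (i + 1) * bernoulli (i + 1) / ((i + 1 : ℕ) : ℂ) ^ 2 * d p r (i + 1)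
          * ((n : ℂ) ^ (i + 1))⁻¹) * (Real.log n : ℂ) ^ (p - r)
      = -∑ i ∈ Finset.range N, logCoeff p (i + 1) n * ((n : ℂ) ^ (i + 1))⁻¹ := by
    simp only [logCoeff, neg_mul, Finset.sum_neg_distrib, neg_neg, Finset.mul_sum, Finset.sum_mul]
    rw [Finset.sum_comm]
    refine Finset.sum_congr rfl fun i _ => Finset.sum_congr rfl fun r _ => ?_
    ring
  rw [iteratedDeriv_natCast_cpow_mul_zero (contDiffAt_of_differentiableOn_ball
      one_half_pos (differentiableOn_powConvFactor N n) p) hn,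
    powConvFactor_zero, Finset.sum_congr rfl fun r hr => by
      rw [choose_mul_iteratedDeriv_powConvFactor_zero N n hr, sub_mul],
    Finset.sum_sub_distrib, hlogCoeff]
  ring

theorem differentiable_powConv (n : ℕ) : Differentiable ℂ fun z => powConv z n :=
  Differentiable.fun_sum fun _ hk =>
    (differentiable_natCast_cpow (Finset.mem_Ico.1 hk).1).div_const _

theorem iteratedDeriv_powConv_zero (p n : ℕ) :
    iteratedDeriv p (fun z => powConv z n) 0 = logSum p n := by
  have hterm (k) (hk : k ∈ Finset.Ico 1 n) :
      ContDiffAt ℂ p (fun z : ℂ => (k : ℂ) ^ z / ((n : ℂ) - k)) 0 :=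
    ((contDiff_natCast_cpow (Finset.mem_Ico.1 hk).1 p).div_const _).contDiffAt
  unfold powConv
  rw [iteratedDeriv_fun_sum hterm, logSum, Complex.ofReal_sum]
  refine Finset.sum_congr rfl fun k hk => ?_
  rw [iteratedDeriv_div_const, iteratedDeriv_natCast_cpow_zero _ (Finset.mem_Ico.1 hk).1]
  push_cast
  rfl

theorem differentiableOn_riemannZeta_neg_add (j : ℕ) :
    DifferentiableOn ℂ (fun z : ℂ => riemannZeta (-(z + j))) (Metric.ball 0 (1 / 2)) := by
  intro z hz
  have hne : -(z + j) ≠ 1 := fun h => add_natCast_succ_ne_zero (neg_half_lt_re_of_mem_ball hz).le j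
    (by linear_combination -h)
  exact ((differentiableAt_riemannZeta hne).comp z (by fun_prop)).differentiableWithinAt

theorem differentiableOn_cpow_mul_powConvFactor (N : ℕ) {n : ℕ} (hn : 1 ≤ n) :
    DifferentiableOn ℂ (fun z => (n : ℂ) ^ z * powConvFactor N n z) (Metric.ball 0 (1 / 2)) :=
  (differentiable_natCast_cpow hn).differentiableOn.mul (differentiableOn_powConvFactor N n)

theorem differentiableOn_powConvError (N M : ℕ) {n : ℕ} (hn : 1 ≤ n) :
    DifferentiableOn ℂ (powConvError N M n) (Metric.ball 0 (1 / 2)) :=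
  ((differentiable_powConv n).differentiableOn.sub
    (differentiableOn_cpow_mul_powConvFactor N hn)).sub
      (DifferentiableOn.fun_sum fun j _ => (differentiableOn_riemannZeta_neg_add j).mul_const _)

theorem iteratedDeriv_riemannZeta_neg_add_zero (p j : ℕ) :
    iteratedDeriv p (fun z : ℂ => riemannZeta (-(z + j))) 0
      = (-1) ^ p * iteratedDeriv p riemannZeta (-j) := by
  simp_rw [neg_add_rev, ← sub_eq_add_neg]
  rw [iteratedDeriv_comp_const_sub]
  simp

theorem iteratedDeriv_powConvError_zero (p N M : ℕ) {n : ℕ} (hn : 1 ≤ n) :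
    iteratedDeriv p (powConvError N M n) 0 = logSum p n
      - ((Real.log n : ℂ) ^ (p + 1) + Real.eulerMascheroniConstant * (Real.log n : ℂ) ^ p
        + ∑ r ∈ Finset.Icc 1 p, c p r * (Real.log n : ℂ) ^ (p - r)
        + ∑ i ∈ Finset.range N, logCoeff p (i + 1) n * ((n : ℂ) ^ (i + 1))⁻¹)
      - ∑ j ∈ Finset.range M,
          (-1) ^ p * iteratedDeriv p riemannZeta (-j) * ((n : ℂ) ^ (j + 1))⁻¹ := by
  have hconv := (differentiable_powConv n).contDiff.contDiffAt (n := p) (x := 0)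
  have hmain := contDiffAt_of_differentiableOn_ball one_half_pos
    (differentiableOn_cpow_mul_powConvFactor N hn) p
  have hzeta (j : ℕ) (_ : j ∈ Finset.range M) := contDiffAt_of_differentiableOn_ball
    one_half_pos ((differentiableOn_riemannZeta_neg_add j).mul_const ((n : ℂ) ^ (j + 1))⁻¹) p
  unfold powConvError
  rw [iteratedDeriv_fun_sub (hconv.sub hmain) (ContDiffAt.sum hzeta),
    iteratedDeriv_fun_sub hconv hmain, iteratedDeriv_fun_sum hzeta, iteratedDeriv_powConv_zero,
    iteratedDeriv_cpow_mul_powConvFactor_zero p N hn]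
  simp only [iteratedDeriv_mul_const_field, iteratedDeriv_riemannZeta_neg_add_zero]

theorem isBigO_iteratedDeriv_powConvError (p N : ℕ) :
    (fun n : ℕ => iteratedDeriv p (powConvError (N + 1) (N + 3) n) 0)
      =O[atTop] fun n => ((n : ℝ) ^ N)⁻¹ := by
  refine isBigO_iteratedDeriv one_half_pos ?_ ?_ p
  · filter_upwards [eventually_ge_atTop 1] with n hn using differentiableOn_powConvError _ _ hn
  · refine ((isBigO_powConvError N (N + 3) (1 / 2)).mono (prod_mono le_rfl
      (principal_mono.2 fun z hz => ?_))).trans (IsBigO.of_bound 1 ?_)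
    · have hre := neg_half_lt_re_of_mem_ball hz
      refine ⟨(mem_ball_zero_iff.1 hz).le, hre.le, ?_⟩
      push_cast
      linarith
    · refine eventually_prod_principal_iff.2 ?_
      filter_upwards [eventually_ge_atTop 1] with n hn z hz
      have hre := (le_abs_self _).trans (Complex.abs_re_le_norm z)
      rw [mem_ball_zero_iff] at hz
      rw [one_mul, ← Real.rpow_natCast, ← Real.rpow_neg n.cast_nonneg,
        Real.norm_of_nonneg (by positivity), Real.norm_of_nonneg (by positivity)]
      refine Real.rpow_le_rpow_of_exponent_le (by exact_mod_cast hn) ?_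
      push_cast
      linarith

end DerivativesAtZero

section Expansion

theorem isBigO_sum_range_sub_sum_range {f : ℕ → ℕ → ℂ} {g : ℕ → ℝ}
    (hf : ∀ j, f j =O[atTop] g) {m M : ℕ} (hmM : m ≤ M) :
    (fun n : ℕ => ∑ j ∈ Finset.range M, f j n * ((n : ℂ) ^ (j + 1))⁻¹
        - ∑ j ∈ Finset.range m, f j n * ((n : ℂ) ^ (j + 1))⁻¹)
      =O[atTop] fun n => g n / (n : ℝ) ^ (m + 1) := by
  simp only [← Finset.sum_Ico_eq_sub _ hmM, div_eq_mul_inv]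
  refine IsBigO.fun_sum fun j hj => (hf j).mul (IsBigO.of_bound 1 ?_)
  filter_upwards [eventually_ge_atTop 1] with n hn
  have hn_one : (1 : ℝ) ≤ n := by exact_mod_cast hn
  rw [norm_inv, norm_pow, Complex.norm_natCast, Real.norm_of_nonneg (by positivity), one_mul]
  gcongr
  exact (Finset.mem_Ico.1 hj).1

theorem isBigO_log_pow_log_pow {q k : ℕ} (hqk : q ≤ k) :
    (fun n : ℕ => (Real.log n : ℂ) ^ q) =O[atTop] fun n : ℕ => Real.log n ^ k := by
  refine IsBigO.of_bound 1 ?_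
  filter_upwards [(Real.tendsto_log_atTop.comp tendsto_natCast_atTop_atTop).eventually_ge_atTop 1]
    with n hn
  rw [Function.comp_apply] at hn
  rw [norm_pow, norm_pow, one_mul, Complex.norm_real]
  exact pow_le_pow_right₀ (hn.trans (le_abs_self _)) hqk

theorem isBigO_const_log_pow {E : Type*} [SeminormedAddCommGroup E] (a : E) (k : ℕ) :
    (fun _ : ℕ => a) =O[atTop] fun n : ℕ => Real.log n ^ k :=
  (isBigO_const_const a (one_ne_zero' ℂ) _).trans
    (by simpa only [pow_zero] using isBigO_log_pow_log_pow k.zero_le)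

theorem isBigO_logCoeff (p k : ℕ) :
    (fun n => logCoeff p k n) =O[atTop] fun n : ℕ => Real.log n ^ (p - 1) := by
  refine ((IsBigO.fun_sum fun r hr => ?_).const_mul_left _).neg_left
  exact (isBigO_log_pow_log_pow (Nat.sub_le_sub_left (Finset.mem_Icc.1 hr).1 p)).const_mul_left _

theorem sum_coeff_eq_add (p m n : ℕ) :
    ∑ k ∈ Finset.Icc 1 m, coeff p k n * (1 / (n : ℂ) ^ k)
      = ∑ j ∈ Finset.range m, logCoeff p (j + 1) n * ((n : ℂ) ^ (j + 1))⁻¹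
        + ∑ j ∈ Finset.range m,
            (-1) ^ p * iteratedDeriv p riemannZeta (-j) * ((n : ℂ) ^ (j + 1))⁻¹ := by
  rw [← Finset.Ico_add_one_right_eq_Icc, Finset.sum_Ico_eq_sum_range, Nat.add_sub_cancel,
    ← Finset.sum_add_distrib]
  refine Finset.sum_congr rfl fun j _ => ?_
  rw [add_comm 1 j, coeff_succ, one_div, add_mul]

theorem isBigO_logSum_sub (p m : ℕ) :
    (fun n : ℕ => (logSum p n : ℂ) -
          ((Real.log n : ℂ) ^ (p + 1)
            + (Real.eulerMascheroniConstant : ℂ) * (Real.log n : ℂ) ^ p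
            + ∑ r ∈ Finset.Icc 1 p, c p r * (Real.log n : ℂ) ^ (p - r)
            + ∑ k ∈ Finset.Icc 1 m, coeff p k n * (1 / (n : ℂ) ^ k)))
      =O[atTop] fun n : ℕ => Real.log n ^ (p - 1) / (n : ℝ) ^ (m + 1) := by
  have herror : (fun n : ℕ => iteratedDeriv p (powConvError (m + 1 + 1) (m + 1 + 3) n) 0)
      =O[atTop] fun n : ℕ => Real.log n ^ (p - 1) / (n : ℝ) ^ (m + 1) := by
    refine (isBigO_iteratedDeriv_powConvError p (m + 1)).trans ?_
    simpa only [div_eq_mul_inv, one_mul] using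
      (isBigO_const_log_pow (1 : ℝ) (p - 1)).mul
        (isBigO_refl (fun n : ℕ => ((n : ℝ) ^ (m + 1))⁻¹) _)
  have hlog := isBigO_sum_range_sub_sum_range (fun j => isBigO_logCoeff p (j + 1))
    (by omega : m ≤ m + 1 + 1)
  have hzeta := isBigO_sum_range_sub_sum_range
    (fun j => isBigO_const_log_pow ((-1) ^ p * iteratedDeriv p riemannZeta (-j)) (p - 1))
    (by omega : m ≤ m + 1 + 3)
  refine ((herror.add hlog).add hzeta).congr' ?_ EventuallyEq.rfl
  filter_upwards [eventually_ge_atTop 1] with n hn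
  rw [iteratedDeriv_powConvError_zero p _ _ hn, sum_coeff_eq_add]
  ring

theorem tendsto_log_pow_div_atTop (q : ℕ) :
    Tendsto (fun n : ℕ => Real.log n ^ q / n) atTop (𝓝 0) :=
  (Real.isLittleO_pow_log_id_atTop (n := q)).tendsto_div_nhds_zero.comp tendsto_natCast_atTop_atTop

end Expansion

end LogSum

theorem mainTheorem5 (p : ℕ) (hp : 1 ≤ p) :
    (∀ m : ℕ,
      (fun n : ℕ => (LogSum.logSum p n : ℂ) -
          ((Real.log n : ℂ) ^ (p + 1)
            + (Real.eulerMascheroniConstant : ℂ) * (Real.log n : ℂ) ^ p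
            + ∑ r ∈ Finset.Icc 1 p, LogSum.c p r * (Real.log n : ℂ) ^ (p - r)
            + ∑ k ∈ Finset.Icc 1 m, LogSum.coeff p k n * (1 / (n : ℂ) ^ k)))
        =O[atTop] (fun n : ℕ => Real.log n ^ (p - 1) / (n : ℝ) ^ (m + 1))) ∧
    Tendsto
      (fun n : ℕ => (LogSum.logSum p n : ℂ) -
          ((Real.log n : ℂ) ^ (p + 1)
            + (Real.eulerMascheroniConstant : ℂ) * (Real.log n : ℂ) ^ p
            + ∑ r ∈ Finset.Ico 1 p, LogSum.c p r * (Real.log n : ℂ) ^ (p - r)))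
      atTop (𝓝 ((-1) ^ p * (p.factorial : ℂ) * riemannZeta ((p : ℂ) + 1))) := by
  refine ⟨LogSum.isBigO_logSum_sub p, ?_⟩
  have hc : LogSum.c p p = (-1) ^ p * (p.factorial : ℂ) * riemannZeta ((p : ℂ) + 1) := by
    simp [LogSum.c]
  have herror := (LogSum.isBigO_logSum_sub p 0).trans_tendsto <| by
    simpa only [zero_add, pow_one] using LogSum.tendsto_log_pow_div_atTop (p - 1)
  rw [← hc, ← zero_add (LogSum.c p p)]
  refine (herror.add_const _).congr fun n => ?_
  rw [← Finset.sum_Ico_add_eq_sum_Icc hp, Finset.Icc_eq_empty (by omega), Finset.sum_empty,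
    Nat.sub_self, pow_zero]
  ring
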